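/- Let $B$ be a nonempty compact smooth manifold without boundary of odd dimension $n\ge 3$, and let $\nu\to B$ be a smooth real vector bundle of rank at least $2$. There do not exist structures on $\nu$ which satisfy the soul inequality strictly for all unit vectors. Precisely, let there be given - a smooth Riemannian metric on $B$, with Levi-Civita connection and unnormalized sectional curvature $k_B(X,Y)=\langle R(X,Y)Y,X\rangle$; - a smooth Euclidean structure $\langle\cdot,\cdot\rangle$ on the fibers of $\nu$ and a smooth connection $\nabla$ on $\nu$ compatible with it, with curvature tensor $R^\nabla$; - a smoothly varying algebraic curvature tensor $R^f$ on each fiber of $\nu$, that is, a smooth section of $\nu^*\otimes\nu^*\otimes\nu^*\otimes\nu^*$ with the symmetries of a curvature tensor (antisymmetric in the first two and in the last two arguments, and satisfying the first Bianchi identity), with $k^f(W,V)=R^f(W,V,W,V)$. For $W,V\in\nu_p$ and $X\in T_pB$ let $R^\nabla(W,V)X\in T_pB$ be the vector determined by $\langle R^\nabla(W,V)X,Y\rangle=\langle R^\nabla(X,Y)W,V\rangle$ for all $Y\in T_pB$. Let $D$ denote covariant differentiation of tensors, induced by $\nabla$ and the Levi-Civita connection, and let $(D_XD_Xk^f)(W,V)=(D^2_{X,X}R^f)(W,V,W,V)$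 be the second covariant derivative. Call $V\in\nu_p$ *good* if $$\langle (D_XR^\nabla)(X,Y)W,V\rangle^2 < \left(|R^\nabla(W,V)X|^2+\tfrac23 (D_XD_Xk^f)(W,V)\right)\cdot k_B(X,Y)$$ for all linearly independent $X,Y\in T_pB$ and all $W\in\nu_p$ such that $V,W$ are linearly independent. Then it is impossible that, for every $p\in B$, every unit vector $V\in\nu_p$ is good. -/

import Mathlib

open Bundle FiberBundle VectorField
open scoped Manifold ContDiff

noncomputable section

namespace SoulInequality

section LeviCivita

variable {E : Type*} [NormedAddCommGroup E] [NormedSpace ℝ E] [FiniteDimensional ℝ E]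
  {H : Type*} [TopologicalSpace H] {I : ModelWithCorners ℝ E H}
  {B : Type*} [TopologicalSpace B] [ChartedSpace H B] [IsManifold I ∞ B]
  (g : ContMDiffRiemannianMetric I ∞ E (fun x : B => TangentSpace I x))

instance (x : B) : FiniteDimensional ℝ (TangentSpace I x) :=
  inferInstanceAs (FiniteDimensional ℝ E)

/-- The right-hand side of the Koszul formula for `2 ⟨∇_X Y, Z⟩` at the point `x`. -/
def koszul (Y X Z : Π x : B, TangentSpace I x) (x : B) : ℝ :=
  mvfderiv I (fun y => g.inner y (Y y) (Z y)) x (X x)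
    + mvfderiv I (fun y => g.inner y (X y) (Z y)) x (Y x)
    - mvfderiv I (fun y => g.inner y (X y) (Y y)) x (Z x)
    + g.inner x (mlieBracket I X Y x) (Z x)
    - g.inner x (mlieBracket I Y Z x) (X x)
    + g.inner x (mlieBracket I Z X x) (Y x)

theorem mdifferentiableAt_inner {X Y : Π x : B, TangentSpace I x} {x : B}
    (hX : MDiffAt (T% X) x) (hY : MDiffAt (T% Y) x) :
    MDiffAt (fun y => g.inner y (X y) (Y y)) x := by
  have h : MDifferentiableAt I (I.prod 𝓘(ℝ)) (fun m : B =>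
      TotalSpace.mk' ℝ (E := Bundle.Trivial B ℝ) m (g.inner m (X m) (Y m))) x :=
    MDifferentiableAt.clm_bundle_apply₂ (F₁ := E) (F₂ := E)
      (g.contMDiff.mdifferentiableAt (by simp)) hX hY
  simp only [mdifferentiableAt_totalSpace] at h
  exact h.2

theorem koszul_tensorial_left {Y Z : Π x : B, TangentSpace I x} {x : B}
    (hY : MDiffAt (T% Y) x) (hZ : MDiffAt (T% Z) x) :
    TensorialAt I E (fun X => koszul g Y X Z x) x where
  smul {f X} hf hX := by
    have h1 := mvfderiv_fun_mul hf (mdifferentiableAt_inner g hX hZ)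
    have h2 := mvfderiv_fun_mul hf (mdifferentiableAt_inner g hX hY)
    have e := g.symm x (X x)
    simp [koszul, mlieBracket_smul_left hf hX, mlieBracket_smul_right hf hX, h1, h2, e]
    ring
  add {X X'} hX hX' := by
    have h1 := mvfderiv_fun_add (mdifferentiableAt_inner g hX hZ) (mdifferentiableAt_inner g hX' hZ)
    have h2 := mvfderiv_fun_add (mdifferentiableAt_inner g hX hY) (mdifferentiableAt_inner g hX' hY)
    simp [koszul, mlieBracket_add_left hX hX', mlieBracket_add_right hX hX', h1, h2]
    ring

theorem koszul_tensorial_right {Y X : Π x : B, TangentSpace I x} {x : B}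
    (hY : MDiffAt (T% Y) x) (hX : MDiffAt (T% X) x) :
    TensorialAt I E (fun Z => koszul g Y X Z x) x where
  smul {f Z} hf hZ := by
    have h1 := mvfderiv_fun_mul hf (mdifferentiableAt_inner g hX hZ)
    have h2 := mvfderiv_fun_mul hf (mdifferentiableAt_inner g hY hZ)
    have e := g.symm x (Z x)
    simp [koszul, mlieBracket_smul_left hf hZ, mlieBracket_smul_right hf hZ, h1, h2, e]
    ring
  add {Z Z'} hZ hZ' := by
    have h1 := mvfderiv_fun_add (mdifferentiableAt_inner g hX hZ) (mdifferentiableAt_inner g hX hZ')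
    have h2 := mvfderiv_fun_add (mdifferentiableAt_inner g hY hZ) (mdifferentiableAt_inner g hY hZ')
    simp [koszul, mlieBracket_add_left hZ hZ', mlieBracket_add_right hZ hZ', h1, h2]
    ring

theorem koszul_add {Y Y' X Z : Π x : B, TangentSpace I x} {x : B}
    (hY : MDiffAt (T% Y) x) (hY' : MDiffAt (T% Y') x)
    (hX : MDiffAt (T% X) x) (hZ : MDiffAt (T% Z) x) :
    koszul g (Y + Y') X Z x = koszul g Y X Z x + koszul g Y' X Z x := by
  have h1 := mvfderiv_fun_add (mdifferentiableAt_inner g hY hZ) (mdifferentiableAt_inner g hY' hZ)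
  have h2 := mvfderiv_fun_add (mdifferentiableAt_inner g hX hY) (mdifferentiableAt_inner g hX hY')
  simp [koszul, mlieBracket_add_left hY hY', mlieBracket_add_right hY hY', h1, h2]
  ring

theorem koszul_leibniz {f : B → ℝ} {Y X Z : Π x : B, TangentSpace I x} {x : B}
    (hf : MDiffAt f x) (hY : MDiffAt (T% Y) x)
    (hX : MDiffAt (T% X) x) (hZ : MDiffAt (T% Z) x) :
    koszul g (f • Y) X Z x
      = f x * koszul g Y X Z x + 2 * (mvfderiv I f x (X x) * g.inner x (Y x) (Z x)) := by
  have h1 := mvfderiv_fun_mul hf (mdifferentiableAt_inner g hY hZ)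
  have h2 := mvfderiv_fun_mul hf (mdifferentiableAt_inner g hX hY)
  have e := g.symm x (Y x)
  simp [koszul, mlieBracket_smul_left hf hY, mlieBracket_smul_right hf hY, h1, h2, e]
  ring

/-- The inner product `g_x` as a bilinear form on `T_x B`. -/
def metricForm (x : B) : LinearMap.BilinForm ℝ (TangentSpace I x) :=
  LinearMap.mk₂ ℝ (fun u v => g.inner x u v) (by simp) (by simp) (by simp) (by simp)

theorem metricForm_nondegenerate (x : B) : (metricForm g x).Nondegenerate := by
  constructor <;> intro u hu <;> by_contra h <;> exact (g.pos x u h).ne' (hu u)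

/-- The vector of `T_x B` that represents the functional `φ` with respect to `g_x`. -/
def sharp (x : B) : Module.Dual ℝ (TangentSpace I x) ≃ₗ[ℝ] TangentSpace I x :=
  ((metricForm g x).toDual (metricForm_nondegenerate g x)).symm

theorem inner_sharp (x : B) (φ : Module.Dual ℝ (TangentSpace I x)) (v : TangentSpace I x) :
    g.inner x (sharp g x φ) v = φ v :=
  LinearMap.BilinForm.apply_toDual_symm_apply (B := metricForm g x) φ v

theorem eq_of_inner_eq {x : B} {u v : TangentSpace I x}
    (h : ∀ w, g.inner x u w = g.inner x v w) : u = v := by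
  by_contra hne
  have := g.pos x (u - v) (sub_ne_zero.2 hne)
  rw [g.symm, map_sub, g.symm x _ u, g.symm x _ v, h, sub_self] at this
  exact this.false

open Classical in
/-- The Levi-Civita connection on vector fields: `2 ⟨∇_X Y, Z⟩` is given by the Koszul formula
(at points where `Y` is not differentiable the value is `0` by convention). -/
def leviCivitaFun (Y : Π x : B, TangentSpace I x) (x : B) :
    TangentSpace I x →L[ℝ] TangentSpace I x :=
  if hY : MDiffAt (T% Y) x then
    haveI : T2Space (TangentSpace I x) := inferInstanceAs (T2Space E)
    LinearMap.toContinuousLinearMap ((1 / 2 : ℝ) • (sharp g x).toLinearMap ∘ₗ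
      (ContinuousLinearMap.coeLM ℝ) ∘ₗ
      (TensorialAt.mkHom₂ (fun X Z => koszul g Y X Z x) x
        (fun _ hZ => koszul_tensorial_left g hY hZ)
        (fun _ hX => koszul_tensorial_right g hY hX)).toLinearMap)
  else 0

theorem inner_leviCivitaFun {Y X Z : Π x : B, TangentSpace I x} {x : B}
    (hY : MDiffAt (T% Y) x) (hX : MDiffAt (T% X) x) (hZ : MDiffAt (T% Z) x) :
    g.inner x (leviCivitaFun g Y x (X x)) (Z x) = 1 / 2 * koszul g Y X Z x := by
  have h := TensorialAt.mkHom₂_apply (Φ := fun X Z => koszul g Y X Z x)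
    (fun _ hZ => koszul_tensorial_left g hY hZ)
    (fun _ hX => koszul_tensorial_right g hY hX) hX hZ
  rw [← h]
  simp [leviCivitaFun, hY, inner_sharp]

/-- The Levi-Civita connection of the Riemannian metric `g`. -/
def leviCivita : CovariantDerivative I E (fun x : B => TangentSpace I x) where
  toFun := leviCivitaFun g
  isCovariantDerivativeOnUniv :=
    { add := by
        intro Y Y' x hY hY' _
        ext u
        refine eq_of_inner_eq g fun w => ?_
        have hu := mdifferentiableAt_extend I E u
        have hw := mdifferentiableAt_extend I E w
        have h := inner_leviCivitaFun g (mdifferentiableAt_add_section hY hY') hu hw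
        have h1 := inner_leviCivitaFun g hY hu hw
        have h2 := inner_leviCivitaFun g hY' hu hw
        rw [koszul_add g hY hY' hu hw] at h
        simp only [extend_apply_self] at h h1 h2
        simp only [_root_.add_apply, map_add, h, h1, h2]
        ring
      leibniz := by
        intro Y f x hY hf _
        ext u
        refine eq_of_inner_eq g fun w => ?_
        have hu := mdifferentiableAt_extend I E u
        have hw := mdifferentiableAt_extend I E w
        have h := inner_leviCivitaFun g (hf.smul_section hY) hu hw
        have h1 := inner_leviCivitaFun g hY hu hw
        rw [koszul_leibniz g hf hY hu hw] at h
        simp only [extend_apply_self] at h h1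
        simp [h, h1]
        ring }

/-- The Levi-Civita connection is torsion-free. -/
theorem leviCivita_torsionFree {X Y : Π x : B, TangentSpace I x} {x : B}
    (hX : MDiffAt (T% X) x) (hY : MDiffAt (T% Y) x) :
    leviCivita g Y x (X x) - leviCivita g X x (Y x) = mlieBracket I X Y x := by
  refine eq_of_inner_eq g fun w => ?_
  have hw := mdifferentiableAt_extend I E w
  have h1 := inner_leviCivitaFun g hY hX hw
  have h2 := inner_leviCivitaFun g hX hY hw
  simp only [extend_apply_self] at h1 h2
  simp only [leviCivita, map_sub, _root_.sub_apply, h1, h2, koszul]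
  rw [mlieBracket_swap_apply (V := Y) (W := X), mlieBracket_swap_apply (V := Y) (W := extend E w),
    mlieBracket_swap_apply (V := X) (W := extend E w)]
  simp [g.symm _ (X _) (Y _)]
  ring

/-- The Levi-Civita connection is compatible with `g`. -/
theorem leviCivita_metric {X Y Z : Π x : B, TangentSpace I x} {x : B}
    (hX : MDiffAt (T% X) x) (hY : MDiffAt (T% Y) x) (hZ : MDiffAt (T% Z) x) :
    mvfderiv I (fun y => g.inner y (Y y) (Z y)) x (X x)
      = g.inner x (leviCivita g Y x (X x)) (Z x) + g.inner x (Y x) (leviCivita g Z x (X x)) := by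
  have h1 := inner_leviCivitaFun g hY hX hZ
  have h2 := inner_leviCivitaFun g hZ hX hY
  rw [g.symm x (Y x)]
  simp only [leviCivita, h1, h2, koszul]
  rw [mlieBracket_swap_apply (V := Y) (W := X), mlieBracket_swap_apply (V := Z) (W := Y),
    mlieBracket_swap_apply (V := Z) (W := X)]
  simp [g.symm _ (Z _) (Y _)]
  ring

end LeviCivita

section Curvature

variable {E : Type*} [NormedAddCommGroup E] [NormedSpace ℝ E]
  {H : Type*} [TopologicalSpace H] {I : ModelWithCorners ℝ E H}
  {B : Type*} [TopologicalSpace B] [ChartedSpace H B] [IsManifold I ∞ B]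
  {F : Type*} [NormedAddCommGroup F] [NormedSpace ℝ F]
  {V : B → Type*} [TopologicalSpace (TotalSpace F V)]
  [∀ x, AddCommGroup (V x)] [∀ x, Module ℝ (V x)] [∀ x, TopologicalSpace (V x)]
  [∀ x, IsTopologicalAddGroup (V x)] [∀ x, ContinuousSMul ℝ (V x)]
  [FiberBundle F V]

/-- `R(X, Y)s = ∇_X ∇_Y s - ∇_Y ∇_X s - ∇_[X,Y] s` for vector fields `X`, `Y` and a section `s`. -/
def curvatureOfFields (D : CovariantDerivative I F V)
    (X Y : Π x : B, TangentSpace I x) (s : Π x : B, V x) (x : B) : V x :=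
  D (fun y => D s y (Y y)) x (X x) - D (fun y => D s y (X y)) x (Y x)
    - D s x (mlieBracket I X Y x)

/-- The curvature tensor `R(u, v)w` of a connection: being a tensor, it is computed on the local
extensions of `u`, `v`, `w` with constant coefficients in a trivialization. -/
def curvature (D : CovariantDerivative I F V) {x : B} (u v : TangentSpace I x) (w : V x) : V x :=
  curvatureOfFields D (extend E u) (extend E v) (extend F w) x

/-- The covariant derivative `(D_a R)(u, v)w` of the curvature tensor `R` of `D`, where `nabla` is
the connection used on the tangent bundle. -/
def covDerivCurvature (nabla : CovariantDerivative I E (fun x : B => TangentSpace I x))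
    (D : CovariantDerivative I F V) {x : B} (a u v : TangentSpace I x) (w : V x) : V x :=
  D (fun y => curvature D (extend E u y) (extend E v y) (extend F w y)) x a
    - curvature D (nabla (extend E u) x a) v w
    - curvature D u (nabla (extend E v) x a) w
    - curvature D u v (D (extend F w) x a)

/-- The covariant derivative `D_a T` of a tensor field `T` of type `V × V × V × V → ℝ`. -/
def covDerivTensor (D : CovariantDerivative I F V) (T : Π x : B, V x → V x → V x → V x → ℝ)
    (x : B) (a : TangentSpace I x) (w₁ w₂ w₃ w₄ : V x) : ℝ :=
  mvfderiv I (fun y => T y (extend F w₁ y) (extend F w₂ y) (extend F w₃ y) (extend F w₄ y)) x a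
    - T x (D (extend F w₁) x a) w₂ w₃ w₄
    - T x w₁ (D (extend F w₂) x a) w₃ w₄
    - T x w₁ w₂ (D (extend F w₃) x a) w₄
    - T x w₁ w₂ w₃ (D (extend F w₄) x a)

/-- The second covariant derivative `D²_{a,b} T = D_a (D_b T) - D_{∇_a b} T`, where `nabla` is the
connection used on the tangent bundle. -/
def secondCovDerivTensor (nabla : CovariantDerivative I E (fun x : B => TangentSpace I x))
    (D : CovariantDerivative I F V) (T : Π x : B, V x → V x → V x → V x → ℝ)
    (x : B) (a b : TangentSpace I x) (w₁ w₂ w₃ w₄ : V x) : ℝ :=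
  covDerivTensor D (fun y => covDerivTensor D T y (extend E b y)) x a w₁ w₂ w₃ w₄
    - covDerivTensor D T x (nabla (extend E b) x a) w₁ w₂ w₃ w₄

variable (I F V) in
/-- A smoothly varying algebraic curvature tensor on each fiber of a vector bundle. -/
structure FiberCurvature where
  toFun (x : B) : V x →ₗ[ℝ] V x →ₗ[ℝ] V x →ₗ[ℝ] V x →ₗ[ℝ] ℝ
  antisymm_left (x : B) (a b c d : V x) : toFun x a b c d = -toFun x b a c d
  antisymm_right (x : B) (a b c d : V x) : toFun x a b c d = -toFun x a b d c
  bianchi (x : B) (a b c d : V x) : toFun x a b c d + toFun x b c a d + toFun x c a b d = 0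
  smooth (x : B) (s₁ s₂ s₃ s₄ : Π y : B, V y)
    (h₁ : ContMDiffAt I (I.prod 𝓘(ℝ, F)) ∞ (T% s₁) x)
    (h₂ : ContMDiffAt I (I.prod 𝓘(ℝ, F)) ∞ (T% s₂) x)
    (h₃ : ContMDiffAt I (I.prod 𝓘(ℝ, F)) ∞ (T% s₃) x)
    (h₄ : ContMDiffAt I (I.prod 𝓘(ℝ, F)) ∞ (T% s₄) x) :
    ContMDiffAt I 𝓘(ℝ, ℝ) ∞ (fun y => toFun y (s₁ y) (s₂ y) (s₃ y) (s₄ y)) x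

end Curvature

section SoulInequality

variable {E : Type*} [NormedAddCommGroup E] [NormedSpace ℝ E] [FiniteDimensional ℝ E]
  {H : Type*} [TopologicalSpace H] {I : ModelWithCorners ℝ E H}
  {B : Type*} [TopologicalSpace B] [ChartedSpace H B] [IsManifold I ∞ B]
  {F : Type*} [NormedAddCommGroup F] [NormedSpace ℝ F]
  {V : B → Type*} [TopologicalSpace (TotalSpace F V)]
  [∀ x, NormedAddCommGroup (V x)] [∀ x, InnerProductSpace ℝ (V x)]
  [FiberBundle F V]

/-- The unnormalized sectional curvature `k_B(X, Y) = ⟨R(X, Y)Y, X⟩` of the base. -/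
def baseCurvature (g : ContMDiffRiemannianMetric I ∞ E (fun x : B => TangentSpace I x))
    {p : B} (X Y : TangentSpace I p) : ℝ :=
  g.inner p (curvature (leviCivita g) X Y Y) X

/-- The vector `R^∇(W, U)X` of `T_p B` with `⟨R^∇(W, U)X, Y⟩ = ⟨R^∇(X, Y)W, U⟩` for all `Y`. -/
def curvatureVector (g : ContMDiffRiemannianMetric I ∞ E (fun x : B => TangentSpace I x))
    (D : CovariantDerivative I F V) {p : B} (W U : V p) (X : TangentSpace I p) :
    TangentSpace I p :=
  sharp g p ((Module.finBasis ℝ (TangentSpace I p)).constr ℝ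
    (fun i => inner ℝ (curvature D X (Module.finBasis ℝ (TangentSpace I p) i) W) U))

/-- `(D_X D_X k^f)(W, U)` for the unnormalized sectional curvature
`k^f(W, U) = R^f(W, U, W, U)` of the fibers. -/
def secondDerivFiberCurvature
    (g : ContMDiffRiemannianMetric I ∞ E (fun x : B => TangentSpace I x))
    (D : CovariantDerivative I F V) (Rf : FiberCurvature I F V)
    {p : B} (X : TangentSpace I p) (W U : V p) : ℝ :=
  secondCovDerivTensor (leviCivita g) D (fun x a b c d => Rf.toFun x a b c d) p X X W U W U

/-- `U` is good: the soul inequality is strict at `X, Y, U, W` as soon as `X ∧ Y ≠ 0` and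
`U ∧ W ≠ 0`. -/
def IsGood (g : ContMDiffRiemannianMetric I ∞ E (fun x : B => TangentSpace I x))
    (D : CovariantDerivative I F V) (Rf : FiberCurvature I F V) {p : B} (U : V p) : Prop :=
  ∀ (X Y : TangentSpace I p) (W : V p),
    LinearIndependent ℝ ![X, Y] → LinearIndependent ℝ ![U, W] →
    inner ℝ (covDerivCurvature (leviCivita g) D X X Y W) U ^ 2 <
      (g.inner p (curvatureVector g D W U X) (curvatureVector g D W U X)
        + 2 / 3 * secondDerivFiberCurvature g D Rf X W U) * baseCurvature g X Y

end SoulInequality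

end SoulInequality

end

open scoped Topology

set_option linter.unusedSectionVars false

noncomputable section

/-! Suppose that every unit vector is good. The left side of the soul inequality is a square, so for
orthonormal `W, U` and independent `X, Y` the product `(|R(W,U)X|² + ⅔ (D_X D_X k^f)(W,U)) ·
k_B(X,Y)` is positive. In particular `k_B` vanishes on no plane. In dimension at least three this
forces one sign of `k_B` on each tangent space (`pos_of_pos`). Hence the points of positive and of
negative curvature form two complementary open sets, both compact; `B` need not be connected.

On the positive part the first factor must be positive for every `X ≠ 0`. Choose `W, U` maximising
`k^f` among all orthonormal pairs over that part. Since the part is open, this is a local maximum in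
`B`, and all second derivatives `(D_X D_X k^f)(W,U)` are nonpositive
(`secondDerivFiberCurvature_nonpos_of_max`). The form `(X,Y) ↦ ⟨R(X,Y)W,U⟩` is skew on a space of
odd dimension, so some `X ≠ 0` has `R(W,U)X = 0` (`exists_curvatureVector_eq_zero`). For this `X`
the first factor is nonpositive, a contradiction. On the negative part the same argument applies to
`-R^f`, that is, to a minimum of `k^f`.

The second derivative test is made on sections whose first two covariant derivatives along `X`
vanish at the point (`exists_flat_section`). On these, `D_X D_X` of a tensor is the ordinary second
derivative of a function (`covDerivTensor_covDerivTensor_eq`). The rest shows that the pointwise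
definitions by chosen extensions are tensorial and smooth. -/

namespace SoulInequality

/-! ### Germs of smooth functions and sections -/

section SmoothNear

variable {E : Type*} [NormedAddCommGroup E] [NormedSpace ℝ E]
  {H : Type*} [TopologicalSpace H] (I : ModelWithCorners ℝ E H)
  {B : Type*} [TopologicalSpace B] [ChartedSpace H B]
  (F : Type*) [NormedAddCommGroup F] [NormedSpace ℝ F]
  {V : B → Type*} [TopologicalSpace (TotalSpace F V)]
  [∀ x, AddCommGroup (V x)] [∀ x, Module ℝ (V x)] [∀ x, TopologicalSpace (V x)]
  [FiberBundle F V]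

/-- The section `s` is smooth on a neighbourhood of `x`. -/
def SmoothNear (s : Π x, V x) (x : B) : Prop :=
  ∀ᶠ y in 𝓝 x, ContMDiffAt I (I.prod 𝓘(ℝ, F)) ∞ (T% s) y

/-- The real function `f` is smooth on a neighbourhood of `x`. -/
def SmoothFunNear (f : B → ℝ) (x : B) : Prop :=
  ∀ᶠ y in 𝓝 x, ContMDiffAt I 𝓘(ℝ, ℝ) ∞ f y

variable {I F} {s t : Π x, V x} {f g : B → ℝ} {x : B}

theorem SmoothNear.contMDiffAt (h : SmoothNear I F s x) :
    ContMDiffAt I (I.prod 𝓘(ℝ, F)) ∞ (T% s) x := h.self_of_nhds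

theorem SmoothNear.mdiff (h : SmoothNear I F s x) : MDiffAt (T% s) x :=
  h.self_of_nhds.mdifferentiableAt (by simp)

theorem SmoothFunNear.contMDiffAt (h : SmoothFunNear I f x) :
    ContMDiffAt I 𝓘(ℝ, ℝ) ∞ f x := h.self_of_nhds

theorem SmoothFunNear.mdiff (h : SmoothFunNear I f x) : MDiffAt f x :=
  h.self_of_nhds.mdifferentiableAt (by simp)

theorem SmoothNear.eventually (h : SmoothNear I F s x) : ∀ᶠ y in 𝓝 x, SmoothNear I F s y :=
  h.eventually_nhds

theorem SmoothFunNear.eventually (h : SmoothFunNear I f x) :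
    ∀ᶠ y in 𝓝 x, SmoothFunNear I f y :=
  h.eventually_nhds

theorem SmoothNear.congr (h : SmoothNear I F s x) (e : ∀ᶠ y in 𝓝 x, t y = s y) :
    SmoothNear I F t x := by
  filter_upwards [h, e.eventually_nhds] with y hy ey
  exact hy.congr_of_eventuallyEq (ey.mono fun z hz => by simp [hz])

theorem SmoothFunNear.congr (h : SmoothFunNear I f x) (e : ∀ᶠ y in 𝓝 x, g y = f y) :
    SmoothFunNear I g x := by
  filter_upwards [h, e.eventually_nhds] with y hy ey
  exact hy.congr_of_eventuallyEq ey

theorem smoothFunNear_const (c : ℝ) : SmoothFunNear I (fun _ : B => c) x :=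
  .of_forall fun _ => contMDiffAt_const

theorem SmoothFunNear.add (hf : SmoothFunNear I f x) (hg : SmoothFunNear I g x) :
    SmoothFunNear I (fun y => f y + g y) x := by
  filter_upwards [hf, hg] with y h1 h2 using h1.add h2

theorem SmoothFunNear.sub (hf : SmoothFunNear I f x) (hg : SmoothFunNear I g x) :
    SmoothFunNear I (fun y => f y - g y) x := by
  filter_upwards [hf, hg] with y h1 h2 using h1.sub h2

theorem SmoothFunNear.mul (hf : SmoothFunNear I f x) (hg : SmoothFunNear I g x) :
    SmoothFunNear I (fun y => f y * g y) x := by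
  filter_upwards [hf, hg] with y h1 h2
  exact h1.mul h2

theorem SmoothFunNear.inv (hf : SmoothFunNear I f x) (h0 : f x ≠ 0) :
    SmoothFunNear I (fun y => (f y)⁻¹) x := by
  filter_upwards [hf, hf.contMDiffAt.continuousAt.eventually_ne h0] with y h1 h2
  exact h1.inv₀ h2

variable [VectorBundle ℝ F V]

theorem smoothNear_zero : SmoothNear I F (0 : Π x, V x) x :=
  .of_forall fun y => contMDiff_zeroSection ℝ V y

theorem SmoothNear.add (hs : SmoothNear I F s x) (ht : SmoothNear I F t x) :
    SmoothNear I F (s + t) x := by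
  filter_upwards [hs, ht] with y h1 h2 using h1.add_section h2

theorem SmoothNear.sub (hs : SmoothNear I F s x) (ht : SmoothNear I F t x) :
    SmoothNear I F (s - t) x := by
  filter_upwards [hs, ht] with y h1 h2 using h1.sub_section h2

theorem SmoothNear.smul (hf : SmoothFunNear I f x) (hs : SmoothNear I F s x) :
    SmoothNear I F (f • s) x := by
  filter_upwards [hf, hs] with y h1 h2 using h1.smul_section h2

theorem SmoothNear.sum {ι : Type*} {A : Finset ι} {s : ι → Π x, V x}
    (hs : ∀ i ∈ A, SmoothNear I F (s i) x) :
    SmoothNear I F (fun y => ∑ i ∈ A, s i y) x := by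
  filter_upwards [(Filter.eventually_all_finset A).2 hs] with y hy
  exact .sum_section hy

theorem smoothNear_extend [ContMDiffVectorBundle ∞ F V I] (v : V x) :
    SmoothNear I F (extend F v) x := by
  obtain ⟨u, hu, h⟩ := exists_contMDiffOn_extend (k := ∞) I F v
  filter_upwards [eventually_mem_nhds_iff.2 hu] with y hy using h.contMDiffAt hy

end SmoothNear

/-! ### Derivatives along fields and Lie brackets -/

section Fields

variable {E : Type*} [NormedAddCommGroup E] [NormedSpace ℝ E]
  {H : Type*} [TopologicalSpace H] {I : ModelWithCorners ℝ E H}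
  {B : Type*} [TopologicalSpace B] [ChartedSpace H B] [IsManifold I ∞ B]
  {X Y : Π x : B, TangentSpace I x} {f : B → ℝ} {x : B}

/-- The function is the fibre component of the tangent map of `f` composed with the section `X`, and
at order `∞` the tangent map loses no smoothness. -/
theorem SmoothFunNear.mvfderiv_apply (hf : SmoothFunNear I f x) (hX : SmoothNear I E X x) :
    SmoothFunNear I (fun y => mvfderiv I f y (X y)) x := by
  filter_upwards [hf.eventually, hX] with y hfy hXy
  obtain ⟨u, hu, hou, hyu⟩ := eventually_nhds_iff.1 hfy
  have hfu : CMDiff[u] ∞ f := fun z hz => (hu z hz).contMDiffWithinAt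
  have h1 := hfu.contMDiffOn_tangentMapWithin (m := ∞) (by simp) hou.uniqueMDiffOn
  have h2 : ContMDiffAt I.tangent 𝓘(ℝ, ℝ).tangent ∞ (tangentMapWithin I 𝓘(ℝ, ℝ) f u)
      (T% X y) := h1.contMDiffAt ((hou.preimage
        (FiberBundle.continuous_proj E (TangentSpace I))).mem_nhds hyu)
  have h3 := h2.comp y hXy
  rw [contMDiffAt_totalSpace] at h3
  refine h3.2.congr_of_eventuallyEq ?_
  filter_upwards [hou.mem_nhds hyu] with z hz
  simp [tangentMapWithin, mfderivWithin_of_isOpen hou hz, mvfderiv]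
  rfl

theorem SmoothNear.mlieBracket [CompleteSpace E] (hX : SmoothNear I E X x) (hY : SmoothNear I E Y x) :
    SmoothNear I E (mlieBracket I X Y) x := by
  filter_upwards [hX, hY] with y h1 h2
  have : IsManifold I (minSmoothness ℝ 2) B := .of_le (n := ∞) (by
    rw [minSmoothness_of_isRCLikeNormedField]
    exact WithTop.coe_le_coe.2 (le_top (a := (2 : ℕ∞))))
  have : IsManifold I (((⊤ : ℕ∞) : ℕ∞ω) + 1) B := .of_le (n := ∞) (by simp)
  exact ContMDiffAt.mlieBracket_vectorField (n := ⊤) (m := ⊤) h1 h2 (by simp)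

end Fields

/-! ### Smoothness of connections -/

section Connection

variable {E : Type*} [NormedAddCommGroup E] [NormedSpace ℝ E] [FiniteDimensional ℝ E]
  {H : Type*} [TopologicalSpace H] {I : ModelWithCorners ℝ E H}
  {B : Type*} [TopologicalSpace B] [T2Space B] [ChartedSpace H B] [IsManifold I ∞ B]
  {F : Type*} [NormedAddCommGroup F] [NormedSpace ℝ F]
  {V : B → Type*} [TopologicalSpace (TotalSpace F V)]
  [∀ x, AddCommGroup (V x)] [∀ x, Module ℝ (V x)] [∀ x, TopologicalSpace (V x)]
  [∀ x, IsTopologicalAddGroup (V x)] [∀ x, ContinuousSMul ℝ (V x)]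
  [FiberBundle F V] [VectorBundle ℝ F V]

/-- The connection `D` maps smooth fields and smooth sections to smooth sections. -/
def PreservesSmooth (D : CovariantDerivative I F V) : Prop :=
  ∀ ⦃X : Π x : B, TangentSpace I x⦄ ⦃s : Π x, V x⦄ ⦃x : B⦄, SmoothNear I E X x →
    SmoothNear I F s x → SmoothNear I F (fun y => D s y (X y)) x

/-- Smoothness of `D` is given for globally smooth sections, so `s` is first cut off by a bump
function. This changes nothing near `x`, because `D` is local. -/
theorem preservesSmooth_of_contMDiff (D : CovariantDerivative I F V)
    [D.ContMDiffCovariantDerivative ∞] : PreservesSmooth D := by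
  intro X s x hX hs
  obtain ⟨u, hu, hou, hxu⟩ := eventually_nhds_iff.1 hs
  obtain ⟨ψ, hψ, -⟩ := (SmoothBumpFunction.nhds_basis_support (I := I)
    (hou.mem_nhds hxu)).mem_iff.1 (hou.mem_nhds hxu)
  have hg : CMDiff ∞ (T% ((ψ : B → ℝ) • s)) :=
    ContMDiffOn.smul_section_of_tsupport ψ.contMDiff.contMDiffOn hou hψ
      fun z hz => (hu z hz).contMDiffWithinAt
  have hD := (CovariantDerivative.ContMDiffCovariantDerivative.contMDiff
    (cov := D) (k := ∞)).contMDiff (σ := (ψ : B → ℝ) • s) (by simpa using hg.contMDiffOn)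
  have hs1 : SmoothNear I F (fun y => D ((ψ : B → ℝ) • s) y (X y)) x := by
    filter_upwards [hX] with y hy
    exact (hD.contMDiffAt Filter.univ_mem).clm_bundle_apply hy
  refine hs1.congr ?_
  filter_upwards [ψ.eventuallyEq_one.eventually_nhds, hs] with y hy hsy
  rw [D.isCovariantDerivativeOnUniv.congr_of_eventuallyEq
    (hsy.mdifferentiableAt (by simp)) (hg.mdifferentiableAt (by simp)) Filter.univ_mem]
  filter_upwards [hy] with z hz
  simp [hz]

end Connection

/-! ### Tensorial operations depend only on the value at the point -/

section Tensoriality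

variable {E : Type*} [NormedAddCommGroup E] [NormedSpace ℝ E]
  {H : Type*} [TopologicalSpace H] (I : ModelWithCorners ℝ E H)
  {B : Type*} [TopologicalSpace B] [ChartedSpace H B]
  (F : Type*) [NormedAddCommGroup F] [NormedSpace ℝ F]
  {V : B → Type*} [TopologicalSpace (TotalSpace F V)]
  [∀ x, AddCommGroup (V x)] [∀ x, Module ℝ (V x)] [∀ x, TopologicalSpace (V x)]
  [FiberBundle F V]
  {A : Type*} [AddCommGroup A] [Module ℝ A]

/-- The operation `Φ` is linear over germs at `x` of smooth functions, on sections that are smooth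
near `x`. -/
structure SmoothTensorialAt (Φ : (Π x, V x) → A) (x : B) : Prop where
  smul {f : B → ℝ} {s : Π x, V x} : SmoothFunNear I f x → SmoothNear I F s x →
    Φ (f • s) = f x • Φ s
  add {s t : Π x, V x} : SmoothNear I F s x → SmoothNear I F t x → Φ (s + t) = Φ s + Φ t

namespace SmoothTensorialAt

variable {I F} {Φ : (Π x, V x) → A} {x : B} {s t : Π x, V x}

/-- The indicator `ψ` of the set where `s = t` is identically one near `x`, hence an admissible
multiplier, and `ψ • s = ψ • t` everywhere. No bump function is needed. -/
theorem congr_of_eventually (h : SmoothTensorialAt I F Φ x) (hs : SmoothNear I F s x)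
    (ht : SmoothNear I F t x) (e : ∀ᶠ y in 𝓝 x, s y = t y) : Φ s = Φ t := by
  classical
  let ψ (y : B) : ℝ := if s y = t y then 1 else 0
  have hx : ψ x = 1 := by simp [ψ, e.self_of_nhds]
  have hψ : SmoothFunNear I ψ x :=
    (smoothFunNear_const 1).congr (e.mono fun y hy => by simp [ψ, hy])
  have hst : ψ • s = ψ • t := by
    funext y
    dsimp [ψ]
    split_ifs with hy <;> simp [hy]
  have h1 := h.smul hψ hs
  have h2 := h.smul hψ ht
  rw [hst, h2] at h1
  simpa [hx] using h1.symm

variable [VectorBundle ℝ F V]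

theorem zero (h : SmoothTensorialAt I F Φ x) : Φ 0 = 0 := by
  have := h.smul (f := fun _ => 0) (s := 0) (smoothFunNear_const 0) smoothNear_zero
  simpa using this

theorem sum (h : SmoothTensorialAt I F Φ x) {ι : Type*} {S : Finset ι} {σ : ι → Π x, V x}
    (hσ : ∀ i ∈ S, SmoothNear I F (σ i) x) :
    Φ (fun y => ∑ i ∈ S, σ i y) = ∑ i ∈ S, Φ (σ i) := by
  classical
  induction S using Finset.induction_on with
  | empty => simpa using! h.zero
  | insert a S ha ih =>
    simp only [Finset.mem_insert, forall_eq_or_imp] at hσ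
    simp only [Finset.sum_insert ha, ← ih hσ.2]
    exact h.add hσ.1 (.sum hσ.2)

variable [FiniteDimensional ℝ F] [ContMDiffVectorBundle ∞ F V I]

/-- A smoothly tensorial operation depends only on the value of the section at the point. -/
theorem pointwise (h : SmoothTensorialAt I F Φ x) (hs : SmoothNear I F s x)
    (ht : SmoothNear I F t x) (hst : s x = t x) : Φ s = Φ t := by
  let e := trivializationAt F V x
  have hxe : x ∈ e.baseSet := FiberBundle.mem_baseSet_trivializationAt F V x
  let b := Module.Basis.ofVectorSpace ℝ F
  have hb (i) : SmoothNear I F (e.localFrame b i) x := by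
    filter_upwards [e.open_baseSet.mem_nhds hxe] with y hy
    exact contMDiffAt_localFrame_of_mem ∞ e b i hy
  have hc {σ : Π x, V x} (hσ : SmoothNear I F σ x) (i) :
      SmoothFunNear I (LinearMap.piApply (e.localFrameCoeff I b i) σ) x := by
    filter_upwards [e.open_baseSet.mem_nhds hxe, hσ] with y hy hσy
    exact contMDiffAt_localFrameCoeff b hy hσy i
  -- Expanding `σ` in a local frame shows that only its coefficients at `x` enter `Φ σ`.
  have key {σ : Π x, V x} (hσ : SmoothNear I F σ x) :
      Φ σ = ∑ i, e.localFrameCoeff I b i x (σ x) • Φ (e.localFrame b i) := by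
    rw [h.congr_of_eventually hσ (.sum fun i _ => (hb i).smul (hc hσ i))
      (e.eventually_eq_localFrame_sum_coeff_smul b hxe), h.sum fun i _ => (hb i).smul (hc hσ i)]
    exact Finset.sum_congr rfl fun i _ => h.smul (hc hσ i) (hb i)
  rw [key hs, key ht, hst]

end SmoothTensorialAt

end Tensoriality

/-! ### Covariant derivatives of four-tensors -/

section TensorDerivative

/-- `T` is linear in each of its four arguments. -/
structure IsQuadrilinear {U : Type*} [AddCommGroup U] [Module ℝ U] (T : U → U → U → U → ℝ) :
    Prop where
  add₁ (a a' b c d : U) : T (a + a') b c d = T a b c d + T a' b c d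
  add₂ (a b b' c d : U) : T a (b + b') c d = T a b c d + T a b' c d
  add₃ (a b c c' d : U) : T a b (c + c') d = T a b c d + T a b c' d
  add₄ (a b c d d' : U) : T a b c (d + d') = T a b c d + T a b c d'
  smul₁ (r : ℝ) (a b c d : U) : T (r • a) b c d = r * T a b c d
  smul₂ (r : ℝ) (a b c d : U) : T a (r • b) c d = r * T a b c d
  smul₃ (r : ℝ) (a b c d : U) : T a b (r • c) d = r * T a b c d
  smul₄ (r : ℝ) (a b c d : U) : T a b c (r • d) = r * T a b c d

namespace IsQuadrilinear

variable {U : Type*} [AddCommGroup U] [Module ℝ U] {T : U → U → U → U → ℝ}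

theorem zero₁ (h : IsQuadrilinear T) (b c d : U) : T 0 b c d = 0 := by
  simpa using h.smul₁ 0 0 b c d

theorem zero₂ (h : IsQuadrilinear T) (a c d : U) : T a 0 c d = 0 := by
  simpa using h.smul₂ 0 a 0 c d

theorem zero₃ (h : IsQuadrilinear T) (a b d : U) : T a b 0 d = 0 := by
  simpa using h.smul₃ 0 a b 0 d

theorem zero₄ (h : IsQuadrilinear T) (a b c : U) : T a b c 0 = 0 := by
  simpa using h.smul₄ 0 a b c 0

end IsQuadrilinear

variable {E : Type*} [NormedAddCommGroup E] [NormedSpace ℝ E]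
  {H : Type*} [TopologicalSpace H] {I : ModelWithCorners ℝ E H}
  {B : Type*} [TopologicalSpace B] [ChartedSpace H B] [IsManifold I ∞ B]
  {F : Type*} [NormedAddCommGroup F] [NormedSpace ℝ F]
  {V : B → Type*} [TopologicalSpace (TotalSpace F V)]
  [∀ x, AddCommGroup (V x)] [∀ x, Module ℝ (V x)] [∀ x, TopologicalSpace (V x)]
  [∀ x, IsTopologicalAddGroup (V x)] [∀ x, ContinuousSMul ℝ (V x)]
  [FiberBundle F V]

variable (I F) in
/-- The tensor field `T` is linear in each argument and smooth near `x` on smooth sections. -/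
structure IsSmoothTensor (T : Π x : B, V x → V x → V x → V x → ℝ) (x : B) : Prop where
  lin (y : B) : IsQuadrilinear (T y)
  smooth {s₁ s₂ s₃ s₄ : Π y, V y} : SmoothNear I F s₁ x → SmoothNear I F s₂ x →
    SmoothNear I F s₃ x → SmoothNear I F s₄ x →
    SmoothFunNear I (fun y => T y (s₁ y) (s₂ y) (s₃ y) (s₄ y)) x

/-- The Leibniz formula for `(D_a T)(s₁, s₂, s₃, s₄)` on sections. -/
def covDerivTensorOfSections (D : CovariantDerivative I F V)
    (T : Π x : B, V x → V x → V x → V x → ℝ) (x : B) (a : TangentSpace I x)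
    (s₁ s₂ s₃ s₄ : Π y, V y) : ℝ :=
  mvfderiv I (fun y => T y (s₁ y) (s₂ y) (s₃ y) (s₄ y)) x a
    - T x (D s₁ x a) (s₂ x) (s₃ x) (s₄ x)
    - T x (s₁ x) (D s₂ x a) (s₃ x) (s₄ x)
    - T x (s₁ x) (s₂ x) (D s₃ x a) (s₄ x)
    - T x (s₁ x) (s₂ x) (s₃ x) (D s₄ x a)

variable [VectorBundle ℝ F V]
  {D : CovariantDerivative I F V} {T : Π x : B, V x → V x → V x → V x → ℝ} {x : B}
  {s₁ s₂ s₃ s₄ : Π y, V y}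

/-- The term `df(a) T(s, …)` from differentiating the function cancels the one from `D (f • s)`. The
other three slots work in the same way. -/
theorem IsSmoothTensor.tensorial₁ (hT : IsSmoothTensor I F T x) (a : TangentSpace I x)
    (h₂ : SmoothNear I F s₂ x) (h₃ : SmoothNear I F s₃ x) (h₄ : SmoothNear I F s₄ x) :
    SmoothTensorialAt I F (fun s => covDerivTensorOfSections D T x a s s₂ s₃ s₄) x where
  smul {f s} hf hs := by
    have h := mvfderiv_fun_mul hf.mdiff (hT.smooth hs h₂ h₃ h₄).mdiff
    simp [covDerivTensorOfSections, (hT.lin _).smul₁, (hT.lin _).add₁, h,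
      D.isCovariantDerivativeOnUniv.leibniz hs.mdiff hf.mdiff]
    ring
  add {s t} hs ht := by
    have h := mvfderiv_fun_add (hT.smooth hs h₂ h₃ h₄).mdiff (hT.smooth ht h₂ h₃ h₄).mdiff
    simp [covDerivTensorOfSections, (hT.lin _).add₁, h,
      D.isCovariantDerivativeOnUniv.add hs.mdiff ht.mdiff]
    ring

theorem IsSmoothTensor.tensorial₂ (hT : IsSmoothTensor I F T x) (a : TangentSpace I x)
    (h₁ : SmoothNear I F s₁ x) (h₃ : SmoothNear I F s₃ x) (h₄ : SmoothNear I F s₄ x) :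
    SmoothTensorialAt I F (fun s => covDerivTensorOfSections D T x a s₁ s s₃ s₄) x where
  smul {f s} hf hs := by
    have h := mvfderiv_fun_mul hf.mdiff (hT.smooth h₁ hs h₃ h₄).mdiff
    simp [covDerivTensorOfSections, (hT.lin _).smul₂, (hT.lin _).add₂, h,
      D.isCovariantDerivativeOnUniv.leibniz hs.mdiff hf.mdiff]
    ring
  add {s t} hs ht := by
    have h := mvfderiv_fun_add (hT.smooth h₁ hs h₃ h₄).mdiff (hT.smooth h₁ ht h₃ h₄).mdiff
    simp [covDerivTensorOfSections, (hT.lin _).add₂, h,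
      D.isCovariantDerivativeOnUniv.add hs.mdiff ht.mdiff]
    ring

theorem IsSmoothTensor.tensorial₃ (hT : IsSmoothTensor I F T x) (a : TangentSpace I x)
    (h₁ : SmoothNear I F s₁ x) (h₂ : SmoothNear I F s₂ x) (h₄ : SmoothNear I F s₄ x) :
    SmoothTensorialAt I F (fun s => covDerivTensorOfSections D T x a s₁ s₂ s s₄) x where
  smul {f s} hf hs := by
    have h := mvfderiv_fun_mul hf.mdiff (hT.smooth h₁ h₂ hs h₄).mdiff
    simp [covDerivTensorOfSections, (hT.lin _).smul₃, (hT.lin _).add₃, h,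
      D.isCovariantDerivativeOnUniv.leibniz hs.mdiff hf.mdiff]
    ring
  add {s t} hs ht := by
    have h := mvfderiv_fun_add (hT.smooth h₁ h₂ hs h₄).mdiff (hT.smooth h₁ h₂ ht h₄).mdiff
    simp [covDerivTensorOfSections, (hT.lin _).add₃, h,
      D.isCovariantDerivativeOnUniv.add hs.mdiff ht.mdiff]
    ring

theorem IsSmoothTensor.tensorial₄ (hT : IsSmoothTensor I F T x) (a : TangentSpace I x)
    (h₁ : SmoothNear I F s₁ x) (h₂ : SmoothNear I F s₂ x) (h₃ : SmoothNear I F s₃ x) :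
    SmoothTensorialAt I F (fun s => covDerivTensorOfSections D T x a s₁ s₂ s₃ s) x where
  smul {f s} hf hs := by
    have h := mvfderiv_fun_mul hf.mdiff (hT.smooth h₁ h₂ h₃ hs).mdiff
    simp [covDerivTensorOfSections, (hT.lin _).smul₄, (hT.lin _).add₄, h,
      D.isCovariantDerivativeOnUniv.leibniz hs.mdiff hf.mdiff]
    ring
  add {s t} hs ht := by
    have h := mvfderiv_fun_add (hT.smooth h₁ h₂ h₃ hs).mdiff (hT.smooth h₁ h₂ h₃ ht).mdiff
    simp [covDerivTensorOfSections, (hT.lin _).add₄, h,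
      D.isCovariantDerivativeOnUniv.add hs.mdiff ht.mdiff]
    ring

variable [FiniteDimensional ℝ F] [ContMDiffVectorBundle ∞ F V I]

/-- The covariant derivative of a smooth tensor field may be computed on any smooth sections. -/
theorem covDerivTensor_eq (hT : IsSmoothTensor I F T x) (a : TangentSpace I x)
    (h₁ : SmoothNear I F s₁ x) (h₂ : SmoothNear I F s₂ x)
    (h₃ : SmoothNear I F s₃ x) (h₄ : SmoothNear I F s₄ x) :
    covDerivTensor D T x a (s₁ x) (s₂ x) (s₃ x) (s₄ x)
      = covDerivTensorOfSections D T x a s₁ s₂ s₃ s₄ := by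
  have e (v : V x) : SmoothNear I F (extend F v) x := smoothNear_extend v
  -- The sections are exchanged for the chosen extensions one slot at a time.
  rw [← (hT.tensorial₁ a h₂ h₃ h₄).pointwise (e (s₁ x)) h₁ (by simp),
    ← (hT.tensorial₂ a (e _) h₃ h₄).pointwise (e (s₂ x)) h₂ (by simp),
    ← (hT.tensorial₃ a (e _) (e _) h₄).pointwise (e (s₃ x)) h₃ (by simp),
    ← (hT.tensorial₄ a (e _) (e _) (e _)).pointwise (e (s₄ x)) h₄ (by simp)]
  simp [covDerivTensor, covDerivTensorOfSections]

/-- The covariant derivative of a smooth tensor field is linear in each argument. -/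
theorem covDerivTensor_lin (hT : IsSmoothTensor I F T x) (a : TangentSpace I x) :
    IsQuadrilinear (covDerivTensor D T x a) := by
  have e (v : V x) : SmoothNear I F (extend F v) x := smoothNear_extend v
  have c (r : ℝ) : SmoothFunNear I (fun _ : B => r) x := smoothFunNear_const r
  have k (w₁ w₂ w₃ w₄ : V x) := covDerivTensor_eq (D := D) hT a (e w₁) (e w₂) (e w₃) (e w₄)
  -- One slot stays an arbitrary section, so that a sum or multiple of extensions can be inserted
  -- there.
  have q₁ {s : Π y, V y} (hs) (w₂ w₃ w₄ : V x) :=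
    covDerivTensor_eq (D := D) (s₁ := s) hT a hs (e w₂) (e w₃) (e w₄)
  have q₂ {s : Π y, V y} (hs) (w₁ w₃ w₄ : V x) :=
    covDerivTensor_eq (D := D) (s₂ := s) hT a (e w₁) hs (e w₃) (e w₄)
  have q₃ {s : Π y, V y} (hs) (w₁ w₂ w₄ : V x) :=
    covDerivTensor_eq (D := D) (s₃ := s) hT a (e w₁) (e w₂) hs (e w₄)
  have q₄ {s : Π y, V y} (hs) (w₁ w₂ w₃ : V x) :=
    covDerivTensor_eq (D := D) (s₄ := s) hT a (e w₁) (e w₂) (e w₃) hs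
  simp only [extend_apply_self] at k q₁ q₂ q₃ q₄
  constructor
  · intro u u' v w z
    have := q₁ ((e u).add (e u')) v w z
    rw [(hT.tensorial₁ a (e v) (e w) (e z)).add (e u) (e u'), ← k, ← k] at this
    simpa using this
  · intro v u u' w z
    have := q₂ ((e u).add (e u')) v w z
    rw [(hT.tensorial₂ a (e v) (e w) (e z)).add (e u) (e u'), ← k, ← k] at this
    simpa using this
  · intro v w u u' z
    have := q₃ ((e u).add (e u')) v w z
    rw [(hT.tensorial₃ a (e v) (e w) (e z)).add (e u) (e u'), ← k, ← k] at this
    simpa using this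
  · intro v w z u u'
    have := q₄ ((e u).add (e u')) v w z
    rw [(hT.tensorial₄ a (e v) (e w) (e z)).add (e u) (e u'), ← k, ← k] at this
    simpa using this
  · intro r u v w z
    have := q₁ ((e u).smul (c r)) v w z
    rw [(hT.tensorial₁ a (e v) (e w) (e z)).smul (c r) (e u), ← k] at this
    simpa using this
  · intro r v u w z
    have := q₂ ((e u).smul (c r)) v w z
    rw [(hT.tensorial₂ a (e v) (e w) (e z)).smul (c r) (e u), ← k] at this
    simpa using this
  · intro r v w u z
    have := q₃ ((e u).smul (c r)) v w z
    rw [(hT.tensorial₃ a (e v) (e w) (e z)).smul (c r) (e u), ← k] at this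
    simpa using this
  · intro r v w z u
    have := q₄ ((e u).smul (c r)) v w z
    rw [(hT.tensorial₄ a (e v) (e w) (e z)).smul (c r) (e u), ← k] at this
    simpa using this

end TensorDerivative

/-! ### Smoothness of the covariant derivative -/

section TensorSmooth

variable {E : Type*} [NormedAddCommGroup E] [NormedSpace ℝ E]
  {H : Type*} [TopologicalSpace H] {I : ModelWithCorners ℝ E H}
  {B : Type*} [TopologicalSpace B] [ChartedSpace H B] [IsManifold I ∞ B]
  {F : Type*} [NormedAddCommGroup F] [NormedSpace ℝ F]
  {V : B → Type*} [TopologicalSpace (TotalSpace F V)]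
  [∀ x, AddCommGroup (V x)] [∀ x, Module ℝ (V x)] [∀ x, TopologicalSpace (V x)]
  [∀ x, IsTopologicalAddGroup (V x)] [∀ x, ContinuousSMul ℝ (V x)]
  [FiberBundle F V] [VectorBundle ℝ F V] [FiniteDimensional ℝ F] [ContMDiffVectorBundle ∞ F V I]

/-- The covariant derivative of a smooth tensor field along a smooth vector field is a smooth
tensor field. -/
theorem isSmoothTensor_covDerivTensor [FiniteDimensional ℝ E] [T2Space B]
    {D : CovariantDerivative I F V} (hD : PreservesSmooth D)
    {T : Π x : B, V x → V x → V x → V x → ℝ} (hT : ∀ x, IsSmoothTensor I F T x)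
    {X : Π x : B, TangentSpace I x} {x : B} (hX : SmoothNear I E X x) :
    IsSmoothTensor I F (fun y => covDerivTensor D T y (X y)) x where
  lin y := covDerivTensor_lin (hT y) _
  smooth {s₁ s₂ s₃ s₄} h₁ h₂ h₃ h₄ := by
    have h : SmoothFunNear I (fun y => covDerivTensorOfSections D T y (X y) s₁ s₂ s₃ s₄) x :=
      (((((hT x).smooth h₁ h₂ h₃ h₄).mvfderiv_apply hX).sub
        ((hT x).smooth (hD hX h₁) h₂ h₃ h₄)).sub ((hT x).smooth h₁ (hD hX h₂) h₃ h₄)).sub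
        ((hT x).smooth h₁ h₂ (hD hX h₃) h₄) |>.sub ((hT x).smooth h₁ h₂ h₃ (hD hX h₄))
    refine h.congr ?_
    filter_upwards [h₁.eventually, h₂.eventually, h₃.eventually, h₄.eventually] with y k₁ k₂ k₃ k₄
    exact covDerivTensor_eq (hT y) _ k₁ k₂ k₃ k₄

end TensorSmooth

/-! ### The bracket as a commutator of derivations -/

section Bracket

variable {E : Type*} [NormedAddCommGroup E] [NormedSpace ℝ E] [CompleteSpace E]
  {H : Type*} [TopologicalSpace H] {I : ModelWithCorners ℝ E H}
  {B : Type*} [TopologicalSpace B] [ChartedSpace H B] [IsManifold I ∞ B]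
  {X Y : Π x : B, TangentSpace I x} {f : B → ℝ} {x : B}

/-- The Lie bracket of vector fields is the commutator of the derivations. -/
theorem mvfderiv_mlieBracket (hf : SmoothFunNear I f x) (hX : SmoothNear I E X x)
    (hY : SmoothNear I E Y x) :
    mvfderiv I f x (mlieBracket I X Y x)
      = mvfderiv I (fun y => mvfderiv I f y (Y y)) x (X x)
        - mvfderiv I (fun y => mvfderiv I f y (X y)) x (Y x) := by
  have i3 : IsManifold I (minSmoothness ℝ 3) B := .of_le (n := ∞) (by
    rw [minSmoothness_of_isRCLikeNormedField]
    exact WithTop.coe_le_coe.2 (le_top (a := (3 : ℕ∞))))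
  have i2 : IsManifold I (minSmoothness ℝ 2) B := .of_le (n := ∞) (by
    rw [minSmoothness_of_isRCLikeNormedField]
    exact WithTop.coe_le_coe.2 (le_top (a := (2 : ℕ∞))))
  -- Both sides vanish on a zero tangent space. Otherwise there is a test field `Z` with `Z x ≠ 0`.
  by_cases h0 : ∀ v : TangentSpace I x, v = 0
  · simp [h0 (mlieBracket I X Y x), h0 (X x), h0 (Y x)]
  push Not at h0
  obtain ⟨v, hv⟩ := h0
  set Z : Π y : B, TangentSpace I y := extend E v
  have hZ : SmoothNear I E Z x := smoothNear_extend v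
  have expand {U : Π y : B, TangentSpace I y} {u : B → ℝ} (W : Π y : B, TangentSpace I y) {y : B}
      (hu : SmoothFunNear I u y) (hU : SmoothNear I E U y) :
      mlieBracket I W (u • U) y = mvfderiv I u y (W y) • U y + u y • mlieBracket I W U y :=
    mlieBracket_smul_right hu.mdiff hU.mdiff
  have two {U : Π y : B, TangentSpace I y} (hU : SmoothNear I E U x) :
      ContMDiffAt I (I.prod 𝓘(ℝ, E)) (minSmoothness ℝ 2) (T% U) x :=
    hU.contMDiffAt.of_le (by
      rw [minSmoothness_of_isRCLikeNormedField]
      exact WithTop.coe_le_coe.2 (le_top (a := (2 : ℕ∞))))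
  have inner {U W : Π y : B, TangentSpace I y} (hU : SmoothNear I E U x)
      (hW : SmoothNear I E W x) :
      mlieBracket I U (mlieBracket I W (f • Z)) x
        = mvfderiv I (fun y => mvfderiv I f y (W y)) x (U x) • Z x
          + mvfderiv I f x (W x) • mlieBracket I U Z x
          + mvfderiv I f x (U x) • mlieBracket I W Z x
          + f x • mlieBracket I U (mlieBracket I W Z) x := by
    have e : mlieBracket I W (f • Z) =ᶠ[𝓝 x]
        (fun y => mvfderiv I f y (W y)) • Z + f • mlieBracket I W Z := by
      filter_upwards [hf.eventually, hZ.eventually] with y h1 h2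
      exact expand W h1 h2
    have h := Filter.EventuallyEq.mlieBracket_vectorField_eq (I := I) (V := U) (V₁ := U) .rfl e
    rw [h,
      mlieBracket_add_right (SmoothNear.smul (hf.mvfderiv_apply hW) hZ).mdiff
        (SmoothNear.smul hf (hW.mlieBracket hZ)).mdiff,
      expand U (hf.mvfderiv_apply hW) hZ, expand U hf (hW.mlieBracket hZ)]
    abel
  -- Subtract `f` times the Jacobi identity for `X, Y, Z` from the one for `X, Y, f • Z`. The mixed
  -- first-order terms are symmetric in `X, Y` and cancel, leaving the claim multiplied by `Z x`.
  have J1 := leibniz_identity_mlieBracket_apply (two hX) (two hY) (two (hZ.smul hf))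
  have J2 := leibniz_identity_mlieBracket_apply (two hX) (two hY) (two hZ)
  rw [inner hX hY, inner hY hX, expand _ hf hZ, J2] at J1
  have key : (mvfderiv I f x (mlieBracket I X Y x)
      - (mvfderiv I (fun y => mvfderiv I f y (Y y)) x (X x)
        - mvfderiv I (fun y => mvfderiv I f y (X y)) x (Y x))) • Z x = 0 := by
    have := sub_eq_zero.2 J1
    rw [← neg_eq_zero, ← this]
    module
  have hZx : Z x ≠ 0 := by simpa [Z] using hv
  exact sub_eq_zero.1 ((smul_eq_zero.1 key).resolve_right hZx)

end Bracket

/-! ### Tensoriality of the curvature -/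

section CurvatureTensor

variable {E : Type*} [NormedAddCommGroup E] [NormedSpace ℝ E] [FiniteDimensional ℝ E]
  {H : Type*} [TopologicalSpace H] {I : ModelWithCorners ℝ E H}
  {B : Type*} [TopologicalSpace B] [T2Space B] [ChartedSpace H B] [IsManifold I ∞ B]
  {F : Type*} [NormedAddCommGroup F] [NormedSpace ℝ F]
  {V : B → Type*} [TopologicalSpace (TotalSpace F V)]
  [∀ x, AddCommGroup (V x)] [∀ x, Module ℝ (V x)] [∀ x, TopologicalSpace (V x)]
  [∀ x, IsTopologicalAddGroup (V x)] [∀ x, ContinuousSMul ℝ (V x)]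
  [FiberBundle F V] [VectorBundle ℝ F V]
  {D : CovariantDerivative I F V} {X Y : Π x : B, TangentSpace I x} {s : Π x, V x} {x : B}

theorem curvatureOfFields_swap (X Y : Π x : B, TangentSpace I x) (s : Π x, V x) (x : B) :
    curvatureOfFields D X Y s x = -curvatureOfFields D Y X s x := by
  simp only [curvatureOfFields]
  rw [mlieBracket_swap_apply, map_neg]
  abel

/-- The extra term `(Y f) D_X s` from differentiating `f • D_X s` cancels the one from `[f X, Y] = f
[X, Y] - (Y f) X`. -/
theorem curvatureOfFields_tensorial_left (hD : PreservesSmooth D) (hY : SmoothNear I E Y x)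
    (hs : SmoothNear I F s x) :
    SmoothTensorialAt I E (fun X => curvatureOfFields D X Y s x) x where
  smul {f X} hf hX := by
    have h : D (fun y => D s y ((f • X) y)) x
        = f x • D (fun y => D s y (X y)) x + (mvfderiv I f x).smulRight (D s x (X x)) := by
      rw [← D.isCovariantDerivativeOnUniv.leibniz (hD hX hs).mdiff hf.mdiff]
      congr 1
      funext y
      simp
    simp only [curvatureOfFields, h, mlieBracket_smul_left hf.mdiff hX.mdiff]
    simp
    module
  add {X X'} hX hX' := by
    have h : D (fun y => D s y ((X + X') y)) x
        = D (fun y => D s y (X y)) x + D (fun y => D s y (X' y)) x := by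
      rw [← D.isCovariantDerivativeOnUniv.add (hD hX hs).mdiff (hD hX' hs).mdiff]
      congr 1
      funext y
      simp
    simp only [curvatureOfFields, h, mlieBracket_add_left hX.mdiff hX'.mdiff]
    simp
    abel

theorem curvatureOfFields_tensorial_mid (hD : PreservesSmooth D) (hX : SmoothNear I E X x)
    (hs : SmoothNear I F s x) :
    SmoothTensorialAt I E (fun Y => curvatureOfFields D X Y s x) x where
  smul {f Y} hf hY := by
    simp only [curvatureOfFields_swap X]
    rw [(curvatureOfFields_tensorial_left hD hX hs).smul hf hY, smul_neg]
  add {Y Y'} hY hY' := by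
    simp only [curvatureOfFields_swap X]
    rw [(curvatureOfFields_tensorial_left hD hX hs).add hY hY', neg_add]

/-- First-order terms in `f` are symmetric in `X, Y` and cancel. The second-order terms give `X(Yf)
- Y(Xf) - [X,Y]f`, which is zero by `mvfderiv_mlieBracket`. -/
theorem curvatureOfFields_tensorial_right (hD : PreservesSmooth D) (hX : SmoothNear I E X x)
    (hY : SmoothNear I E Y x) :
    SmoothTensorialAt I F (fun s => curvatureOfFields D X Y s x) x where
  smul {f s} hf hs := by
    have h {X : Π x : B, TangentSpace I x} (hX : SmoothNear I E X x) :
        D (fun y => D (f • s) y (X y)) x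
          = f x • D (fun y => D s y (X y)) x + (mvfderiv I f x).smulRight (D s x (X x))
            + (mvfderiv I f x (X x) • D s x
              + (mvfderiv I (fun y => mvfderiv I f y (X y)) x).smulRight (s x)) := by
      rw [← D.isCovariantDerivativeOnUniv.leibniz (hD hX hs).mdiff hf.mdiff,
        ← D.isCovariantDerivativeOnUniv.leibniz hs.mdiff (hf.mvfderiv_apply hX).mdiff,
        ← D.isCovariantDerivativeOnUniv.add (SmoothNear.smul hf (hD hX hs)).mdiff
          (SmoothNear.smul (hf.mvfderiv_apply hX) hs).mdiff]
      refine D.isCovariantDerivativeOnUniv.congr_of_eventuallyEq (hD hX (hs.smul hf)).mdiff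
        ((SmoothNear.smul hf (hD hX hs)).add (SmoothNear.smul (hf.mvfderiv_apply hX) hs)).mdiff
        Filter.univ_mem ?_
      filter_upwards [hf.eventually, hs.eventually] with y hfy hsy
      simp [D.isCovariantDerivativeOnUniv.leibniz hsy.mdiff hfy.mdiff]
    simp only [curvatureOfFields, h hX, h hY,
      D.isCovariantDerivativeOnUniv.leibniz hs.mdiff hf.mdiff]
    simp [mvfderiv_mlieBracket hf hX hY]
    module
  add {s t} hs ht := by
    have h {X : Π x : B, TangentSpace I x} (hX : SmoothNear I E X x) :
        D (fun y => D (s + t) y (X y)) x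
          = D (fun y => D s y (X y)) x + D (fun y => D t y (X y)) x := by
      rw [← D.isCovariantDerivativeOnUniv.add (hD hX hs).mdiff (hD hX ht).mdiff]
      refine D.isCovariantDerivativeOnUniv.congr_of_eventuallyEq (hD hX (hs.add ht)).mdiff
        ((hD hX hs).add (hD hX ht)).mdiff Filter.univ_mem ?_
      filter_upwards [hs.eventually, ht.eventually] with y hsy hty
      simp [D.isCovariantDerivativeOnUniv.add hsy.mdiff hty.mdiff]
    simp only [curvatureOfFields, h hX, h hY, D.isCovariantDerivativeOnUniv.add hs.mdiff ht.mdiff]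
    simp
    abel

theorem SmoothNear.curvatureOfFields (hD : PreservesSmooth D) (hX : SmoothNear I E X x)
    (hY : SmoothNear I E Y x) (hs : SmoothNear I F s x) :
    SmoothNear I F (curvatureOfFields D X Y s) x :=
  ((hD hX (hD hY hs)).sub (hD hY (hD hX hs))).sub (hD (hX.mlieBracket hY) hs)

variable [FiniteDimensional ℝ F] [ContMDiffVectorBundle ∞ F V I]

/-- The curvature tensor may be computed on any smooth vector fields and sections. -/
theorem curvature_eq (hD : PreservesSmooth D) (hX : SmoothNear I E X x)
    (hY : SmoothNear I E Y x) (hs : SmoothNear I F s x) :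
    curvature D (X x) (Y x) (s x) = curvatureOfFields D X Y s x := by
  have e (v : TangentSpace I x) : SmoothNear I E (extend E v) x := smoothNear_extend v
  rw [← (curvatureOfFields_tensorial_left hD hY hs).pointwise (e (X x)) hX (by simp),
    ← (curvatureOfFields_tensorial_mid hD (e _) hs).pointwise (e (Y x)) hY (by simp),
    ← (curvatureOfFields_tensorial_right hD (e _) (e _)).pointwise
      (smoothNear_extend (s x)) hs (by simp)]
  rfl

theorem curvature_swap (u v : TangentSpace I x) (w : V x) :
    curvature D u v w = -curvature D v u w :=
  curvatureOfFields_swap _ _ _ _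

theorem curvature_self (u : TangentSpace I x) (w : V x) : curvature D u u w = 0 :=
  by simp [curvature, curvatureOfFields]

theorem curvature_add_left (hD : PreservesSmooth D) (u u' v : TangentSpace I x) (w : V x) :
    curvature D (u + u') v w = curvature D u v w + curvature D u' v w := by
  have e (v : TangentSpace I x) : SmoothNear I E (extend E v) x := smoothNear_extend v
  have h := curvature_eq hD ((e u).add (e u')) (e v) (smoothNear_extend w)
  rw [(curvatureOfFields_tensorial_left hD (e v) (smoothNear_extend w)).add (e u) (e u')] at h
  simpa [curvature] using h

theorem curvature_smul_left (hD : PreservesSmooth D) (r : ℝ) (u v : TangentSpace I x) (w : V x) :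
    curvature D (r • u) v w = r • curvature D u v w := by
  have e (v : TangentSpace I x) : SmoothNear I E (extend E v) x := smoothNear_extend v
  have h := curvature_eq hD ((e u).smul (smoothFunNear_const r)) (e v) (smoothNear_extend w)
  rw [(curvatureOfFields_tensorial_left hD (e v) (smoothNear_extend w)).smul
    (smoothFunNear_const r) (e u)] at h
  simpa [curvature] using h

theorem curvature_add_right (hD : PreservesSmooth D) (u v : TangentSpace I x) (w w' : V x) :
    curvature D u v (w + w') = curvature D u v w + curvature D u v w' := by
  have e (v : TangentSpace I x) : SmoothNear I E (extend E v) x := smoothNear_extend v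
  have f (v : V x) : SmoothNear I F (extend F v) x := smoothNear_extend v
  have h := curvature_eq hD (e u) (e v) ((f w).add (f w'))
  rw [(curvatureOfFields_tensorial_right hD (e u) (e v)).add (f w) (f w')] at h
  simpa [curvature] using h

theorem curvature_smul_right (hD : PreservesSmooth D) (r : ℝ) (u v : TangentSpace I x) (w : V x) :
    curvature D u v (r • w) = r • curvature D u v w := by
  have e (v : TangentSpace I x) : SmoothNear I E (extend E v) x := smoothNear_extend v
  have f (v : V x) : SmoothNear I F (extend F v) x := smoothNear_extend v
  have h := curvature_eq hD (e u) (e v) ((f w).smul (smoothFunNear_const r))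
  rw [(curvatureOfFields_tensorial_right hD (e u) (e v)).smul (smoothFunNear_const r) (f w)] at h
  simpa [curvature] using h

end CurvatureTensor

/-! ### Smooth orthonormal frames -/

section OrthonormalFrame

variable {E : Type*} [NormedAddCommGroup E] [NormedSpace ℝ E]
  {H : Type*} [TopologicalSpace H] {I : ModelWithCorners ℝ E H}
  {B : Type*} [TopologicalSpace B] [ChartedSpace H B]
  {F : Type*} [NormedAddCommGroup F] [NormedSpace ℝ F]
  {V : B → Type*} [TopologicalSpace (TotalSpace F V)]
  [∀ x, NormedAddCommGroup (V x)] [∀ x, InnerProductSpace ℝ (V x)]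
  [FiberBundle F V] [VectorBundle ℝ F V] [IsContMDiffRiemannianBundle I ∞ F V]

theorem SmoothNear.inner {s t : Π x, V x} {x : B} (hs : SmoothNear I F s x)
    (ht : SmoothNear I F t x) : SmoothFunNear I (fun y => inner ℝ (s y) (t y)) x := by
  filter_upwards [hs, ht] with y h1 h2
  exact h1.inner_bundle h2

/-- By induction the recursion divides only by squared norms of earlier vectors, which are nonzero
at `x` by independence and hence near `x`. -/
theorem smoothNear_gramSchmidt {ι : Type*} [LinearOrder ι] [LocallyFiniteOrderBot ι]
    [WellFoundedLT ι] {s : ι → Π x, V x} {x : B} (hs : ∀ i, SmoothNear I F (s i) x)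
    (hl : LinearIndependent ℝ (fun i => s i x)) (i : ι) :
    SmoothNear I F (fun y => InnerProductSpace.gramSchmidt ℝ (fun j => s j y) i) x := by
  induction i using WellFoundedLT.induction with
  | ind i ih =>
    have h : SmoothNear I F (s i - fun y => ∑ j ∈ Finset.Iio i,
        ((inner ℝ (InnerProductSpace.gramSchmidt ℝ (fun j => s j y) j) (s i y)
          * (inner ℝ (InnerProductSpace.gramSchmidt ℝ (fun j => s j y) j)
            (InnerProductSpace.gramSchmidt ℝ (fun j => s j y) j))⁻¹) •
          InnerProductSpace.gramSchmidt ℝ (fun j => s j y) j)) x := by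
      refine (hs i).sub (.sum fun j hj => ?_)
      have hj := ih j (Finset.mem_Iio.1 hj)
      refine SmoothNear.smul ((hj.inner (hs i)).mul ((hj.inner hj).inv ?_)) hj
      exact inner_self_ne_zero.2 (InnerProductSpace.gramSchmidt_ne_zero j hl)
    -- The formula for the projection holds at every `y`, also where a vector vanishes, since
    -- division by zero gives zero.
    refine h.congr (.of_forall fun y => ?_)
    rw [InnerProductSpace.gramSchmidt_def]
    simp only [Pi.sub_apply]
    congr 1
    refine Finset.sum_congr rfl fun j _ => ?_
    rw [Submodule.starProjection_singleton, real_inner_self_eq_norm_sq]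
    rfl

/-- A smooth Riemannian vector bundle has smooth local orthonormal frames. -/
theorem exists_orthonormal_frame [FiniteDimensional ℝ F] [ContMDiffVectorBundle ∞ F V I] (x : B) :
    ∃ e : Fin (Module.finrank ℝ F) → Π y, V y, (∀ i, SmoothNear I F (e i) x) ∧
      ∀ᶠ y in 𝓝 x, Orthonormal ℝ (fun i => e i y) ∧
        ∀ v : V y, v = ∑ i, inner ℝ (e i y) v • e i y := by
  let t := trivializationAt F V x
  have hxt : x ∈ t.baseSet := FiberBundle.mem_baseSet_trivializationAt F V x
  let b := Module.finBasis ℝ F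
  have hfr := t.isLocalFrameOn_localFrame_baseSet I ∞ b
  have hs (i) : SmoothNear I F (t.localFrame b i) x := by
    filter_upwards [t.open_baseSet.mem_nhds hxt] with y hy
    exact contMDiffAt_localFrame_of_mem ∞ t b i hy
  have hg := smoothNear_gramSchmidt hs (hfr.linearIndependent hxt)
  refine ⟨fun i y => InnerProductSpace.gramSchmidtNormed ℝ (fun j => t.localFrame b j y) i,
    fun i => ?_, ?_⟩
  · have h0 := InnerProductSpace.gramSchmidt_ne_zero (𝕜 := ℝ) i (hfr.linearIndependent hxt)
    have hr : SmoothFunNear I (fun y =>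
        √(inner ℝ (InnerProductSpace.gramSchmidt ℝ (fun j => t.localFrame b j y) i)
          (InnerProductSpace.gramSchmidt ℝ (fun j => t.localFrame b j y) i))) x := by
      filter_upwards [(hg i).inner (hg i), ((hg i).inner (hg i)).contMDiffAt.continuousAt.eventually_ne
        (inner_self_ne_zero.2 h0)] with y hy hy0
      exact (Real.contDiffAt_sqrt hy0).contMDiffAt.comp y hy
    refine (SmoothNear.smul (hr.inv ?_) (hg i)).congr (.of_forall fun y => ?_)
    · rw [← norm_eq_sqrt_real_inner]
      exact norm_ne_zero_iff.2 h0
    · simp [InnerProductSpace.gramSchmidtNormed, ← norm_eq_sqrt_real_inner]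
  · filter_upwards [t.open_baseSet.mem_nhds hxt] with y hy
    have ho := InnerProductSpace.gramSchmidtNormed_orthonormal (hfr.linearIndependent hy)
    refine ⟨ho, fun v => ?_⟩
    have hsp : ⊤ ≤ Submodule.span ℝ (Set.range (InnerProductSpace.gramSchmidtNormed ℝ
        (fun j => t.localFrame b j y))) := by
      rw [InnerProductSpace.span_gramSchmidtNormed_range, InnerProductSpace.span_gramSchmidt]
      exact hfr.generating hy
    have := (OrthonormalBasis.mk ho hsp).sum_repr' v
    simpa using this.symm

end OrthonormalFrame

/-! ### Smoothness of the Levi-Civita connection -/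

section LeviCivitaSmooth

variable {E : Type*} [NormedAddCommGroup E] [NormedSpace ℝ E] [FiniteDimensional ℝ E]
  {H : Type*} [TopologicalSpace H] {I : ModelWithCorners ℝ E H}
  {B : Type*} [TopologicalSpace B] [ChartedSpace H B] [IsManifold I ∞ B]
  (g : ContMDiffRiemannianMetric I ∞ E (fun x : B => TangentSpace I x))
  {X Y Z : Π x : B, TangentSpace I x} {x : B}

theorem SmoothNear.metric (hX : SmoothNear I E X x) (hY : SmoothNear I E Y x) :
    SmoothFunNear I (fun y => g.inner y (X y) (Y y)) x :=
  letI : RiemannianBundle (fun x : B => TangentSpace I x) := ⟨g.toRiemannianMetric⟩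
  SmoothNear.inner (V := fun x : B => TangentSpace I x) hX hY

theorem exists_metric_orthonormal_frame (x : B) :
    ∃ e : Fin (Module.finrank ℝ E) → Π y : B, TangentSpace I y, (∀ i, SmoothNear I E (e i) x) ∧
      ∀ᶠ y in 𝓝 x, ∀ v : TangentSpace I y, v = ∑ i, g.inner y (e i y) v • e i y := by
  let : RiemannianBundle (fun x : B => TangentSpace I x) := ⟨g.toRiemannianMetric⟩
  obtain ⟨e, he, h⟩ := exists_orthonormal_frame (I := I) (F := E)
    (V := fun x : B => TangentSpace I x) x
  exact ⟨e, he, h.mono fun y hy => hy.2⟩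

theorem SmoothNear.koszul (hY : SmoothNear I E Y x) (hX : SmoothNear I E X x)
    (hZ : SmoothNear I E Z x) : SmoothFunNear I (koszul g Y X Z) x :=
  ((((((hY.metric g hZ).mvfderiv_apply hX).add ((hX.metric g hZ).mvfderiv_apply hY)).sub
    ((hX.metric g hY).mvfderiv_apply hZ)).add ((hX.mlieBracket hY).metric g hZ)).sub
    ((hY.mlieBracket hZ).metric g hX)).add ((hZ.mlieBracket hX).metric g hY)

/-- The Levi-Civita connection of a smooth metric is smooth. -/
theorem preservesSmooth_leviCivita : PreservesSmooth (leviCivita g) := by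
  intro X Y x hX hY
  obtain ⟨e, he, h⟩ := exists_metric_orthonormal_frame g x
  -- In an orthonormal frame the coefficients of `∇_X Y` are half the Koszul expressions, which are
  -- smooth.
  have hs : SmoothNear I E (fun y => ∑ i, ((1 / 2) * SoulInequality.koszul g Y X (e i) y) • e i y) x :=
    .sum fun i _ => SmoothNear.smul ((smoothFunNear_const (1 / 2)).mul (hY.koszul g hX (he i)))
      (he i)
  refine hs.congr ?_
  filter_upwards [h, hX.eventually, hY.eventually,
    Filter.eventually_all.2 fun i => (he i).eventually] with y hy hXy hYy hey
  rw [hy (leviCivita g Y y (X y))]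
  refine Finset.sum_congr rfl fun i _ => ?_
  rw [← inner_leviCivitaFun g hYy.mdiff hXy.mdiff (hey i).mdiff, g.symm]
  rfl

end LeviCivitaSmooth


/-! ### Constancy of sign on planes -/

section Sign

variable {U : Type*} [AddCommGroup U] [Module ℝ U] [TopologicalSpace U]
  [IsTopologicalAddGroup U] [ContinuousSMul ℝ U] [FiniteDimensional ℝ U]

theorem linearIndependent_pair_of_notMem {X Y : U} (hX : X ≠ 0)
    (hY : Y ∉ Submodule.span ℝ {X}) : LinearIndependent ℝ ![X, Y] :=
  (LinearIndependent.pair_iff' hX).2 fun a ha =>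
    hY (Submodule.mem_span_singleton.2 ⟨a, ha⟩)

/-- The line through `X` has codimension at least two, so its complement is connected, and a
continuous function without zeros there keeps its sign. -/
theorem pos_of_pos_of_fixed_left (hU : 3 ≤ Module.finrank ℝ U) {k : U → U → ℝ}
    (hne : ∀ X Y, LinearIndependent ℝ ![X, Y] → k X Y ≠ 0) {X : U} (hc : Continuous (k X))
    {Y Y' : U} (h : LinearIndependent ℝ ![X, Y]) (h' : LinearIndependent ℝ ![X, Y'])
    (hpos : 0 < k X Y) : 0 < k X Y' := by
  have hX : X ≠ 0 := by simpa using h.ne_zero 0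
  have hcodim : 1 < Module.rank ℝ (U ⧸ Submodule.span ℝ {X}) := by
    have h1 := Submodule.finrank_quotient_add_finrank (Submodule.span ℝ {X})
    rw [finrank_span_singleton hX] at h1
    rw [← Module.finrank_eq_rank]
    exact_mod_cast (by omega : 1 < Module.finrank ℝ (U ⧸ Submodule.span ℝ {X}))
  have mem {Z : U} (hZ : LinearIndependent ℝ ![X, Z]) :
      Z ∈ ((Submodule.span ℝ {X} : Submodule ℝ U) : Set U)ᶜ := fun hZ' => by
    obtain ⟨a, ha⟩ := Submodule.mem_span_singleton.1 hZ'
    exact (LinearIndependent.pair_iff' hX).1 hZ a ha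
  by_contra hneg
  have hlt : k X Y' < 0 := lt_of_le_of_ne (not_lt.1 hneg) (hne X Y' h')
  obtain ⟨Z, hZ, hZ0⟩ := (isConnected_compl_of_one_lt_codim hcodim).isPreconnected.intermediate_value
    (mem h') (mem h) hc.continuousOn ⟨hlt.le, hpos.le⟩
  exact hne X Z (linearIndependent_pair_of_notMem hX hZ) hZ0

/-- A separately continuous function of two vectors that does not vanish on independent pairs has
constant sign on them, in dimension at least three. -/
theorem pos_of_pos (hU : 3 ≤ Module.finrank ℝ U) {k : U → U → ℝ}
    (hne : ∀ X Y, LinearIndependent ℝ ![X, Y] → k X Y ≠ 0) (hc : ∀ X, Continuous (k X))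
    (hc' : ∀ Y, Continuous fun X => k X Y)
    {X Y X' Y' : U} (h : LinearIndependent ℝ ![X, Y]) (h' : LinearIndependent ℝ ![X', Y'])
    (hpos : 0 < k X Y) : 0 < k X' Y' := by
  have hX : X ≠ 0 := by simpa using h.ne_zero 0
  have hX' : X' ≠ 0 := by simpa using h'.ne_zero 0
  -- With `Z` outside the span of `X, X'`, one vector is changed at a time: `(X,Y)`, `(X,Z)`,
  -- `(X',Z)`, `(X',Y')`.
  obtain ⟨Z, hZ⟩ : ∃ Z, Z ∉ Submodule.span ℝ (Set.range ![X, X']) := by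
    by_contra! hall
    have htop : Submodule.span ℝ (Set.range ![X, X']) = ⊤ := Submodule.eq_top_iff'.2 hall
    have h1 := finrank_range_le_card (R := ℝ) ![X, X']
    rw [Set.finrank, htop, finrank_top] at h1
    simp at h1
    omega
  have hXZ : LinearIndependent ℝ ![X, Z] := linearIndependent_pair_of_notMem hX fun hm =>
    hZ (Submodule.span_mono (by simp) hm)
  have hXZ' : LinearIndependent ℝ ![X', Z] := linearIndependent_pair_of_notMem hX' fun hm =>
    hZ (Submodule.span_mono (by simp) hm)
  have h1 := pos_of_pos_of_fixed_left hU hne (hc X) h hXZ hpos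
  have h2 := pos_of_pos_of_fixed_left (k := fun X Y => k Y X) hU
    (fun A C hAC => hne C A (LinearIndependent.pair_symm_iff.1 hAC)) (hc' Z)
    (LinearIndependent.pair_symm_iff.1 hXZ) (LinearIndependent.pair_symm_iff.1 hXZ') h1
  exact pos_of_pos_of_fixed_left hU hne (hc X') hXZ' h' h2

end Sign

/-! ### Continuity of quadratic forms -/

section Quadratic

variable {U : Type*} [AddCommGroup U] [Module ℝ U] [TopologicalSpace U]
  [IsTopologicalAddGroup U] [ContinuousSMul ℝ U] [T2Space U] [FiniteDimensional ℝ U]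

theorem continuous_apply_self (M : U →ₗ[ℝ] U →ₗ[ℝ] ℝ) : Continuous fun u => M u u := by
  let b := Module.finBasis ℝ U
  have h (u : U) : M u u = ∑ i, b.coord i u * M (b i) u := by
    have := congrArg (fun z => M z u) (b.sum_repr u).symm
    simpa only [map_sum, map_smul, LinearMap.sum_apply, LinearMap.smul_apply, smul_eq_mul,
      Module.Basis.coord_apply] using this
  simp only [h]
  exact continuous_finsetSum _ fun i _ => (b.coord i).continuous_of_finiteDimensional.mul
    (M (b i)).continuous_of_finiteDimensional

end Quadratic

/-! ### Continuity of the sectional curvature of the base -/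

section BaseCurvature

variable {E : Type*} [NormedAddCommGroup E] [NormedSpace ℝ E] [FiniteDimensional ℝ E]
  {H : Type*} [TopologicalSpace H] {I : ModelWithCorners ℝ E H}
  {B : Type*} [TopologicalSpace B] [T2Space B] [ChartedSpace H B] [IsManifold I ∞ B]
  (g : ContMDiffRiemannianMetric I ∞ E (fun x : B => TangentSpace I x)) {p : B}

theorem continuousAt_baseCurvature {X Y : Π x : B, TangentSpace I x} (hX : SmoothNear I E X p)
    (hY : SmoothNear I E Y p) : ContinuousAt (fun y => baseCurvature g (X y) (Y y)) p := by
  have hD := preservesSmooth_leviCivita g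
  have h : SmoothFunNear I (fun y => baseCurvature g (X y) (Y y)) p := by
    refine ((SmoothNear.curvatureOfFields hD hX hY hY).metric g hX).congr ?_
    filter_upwards [hX.eventually, hY.eventually] with y hXy hYy
    rw [baseCurvature, curvature_eq hD hXy hYy hYy]
  exact h.contMDiffAt.continuousAt

/-- Contrapositively, a pair with nonzero curvature is independent, so the sign sets below need not
require independence. -/
theorem baseCurvature_eq_zero {X Y : TangentSpace I p} (h : ¬ LinearIndependent ℝ ![X, Y]) :
    baseCurvature g X Y = 0 := by
  have hD := preservesSmooth_leviCivita g
  by_cases hX : X = 0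
  · simp [hX, baseCurvature]
  · rw [LinearIndependent.pair_iff' hX] at h
    push Not at h
    obtain ⟨a, rfl⟩ := h
    have : curvature (leviCivita g) X (a • X) (a • X) = 0 := by
      rw [curvature_swap, curvature_smul_left hD, curvature_self, smul_zero, neg_zero]
    simp [baseCurvature, this]

/-- For fixed `X` this is the diagonal of the bilinear form `(Y,Z) ↦ ⟨R(X,Y)Z,X⟩`. Separate
continuity is all that `pos_of_pos` asks for. -/
theorem continuous_baseCurvature_right (X : TangentSpace I p) :
    Continuous fun Y : TangentSpace I p => baseCurvature g X Y := by
  have hD := preservesSmooth_leviCivita g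
  let M : TangentSpace I p →ₗ[ℝ] TangentSpace I p →ₗ[ℝ] ℝ :=
    LinearMap.mk₂ ℝ (fun Y Z => g.inner p (curvature (leviCivita g) X Y Z) X)
      (fun Y Y' Z => by
        rw [curvature_swap, curvature_add_left hD, neg_add, ← curvature_swap, ← curvature_swap]
        simp)
      (fun c Y Z => by
        rw [curvature_swap, curvature_smul_left hD, ← smul_neg, ← curvature_swap]
        simp)
      (fun Y Z Z' => by simp [curvature_add_right hD])
      (fun c Y Z => by simp [curvature_smul_right hD])
  have : T2Space (TangentSpace I p) := inferInstanceAs (T2Space E)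
  exact continuous_apply_self M

theorem continuous_baseCurvature_left (Y : TangentSpace I p) :
    Continuous fun X : TangentSpace I p => baseCurvature g X Y := by
  have hD := preservesSmooth_leviCivita g
  let M : TangentSpace I p →ₗ[ℝ] TangentSpace I p →ₗ[ℝ] ℝ :=
    LinearMap.mk₂ ℝ (fun X Z => g.inner p (curvature (leviCivita g) X Y Y) Z)
      (fun X X' Z => by simp [curvature_add_left hD])
      (fun c X Z => by simp [curvature_smul_left hD])
      (fun X Z Z' => by simp) (fun c X Z => by simp)
  have : T2Space (TangentSpace I p) := inferInstanceAs (T2Space E)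
  exact continuous_apply_self M

/-- A witnessing pair extends to smooth fields, along which the curvature is continuous. -/
theorem isOpen_setOf_baseCurvature {P : ℝ → Prop} (hP : IsOpen {r | P r}) :
    IsOpen {p : B | ∃ X Y : TangentSpace I p, P (baseCurvature g X Y)} := by
  rw [isOpen_iff_mem_nhds]
  rintro p ⟨X, Y, h⟩
  have hc := continuousAt_baseCurvature g (smoothNear_extend (F := E) X)
    (smoothNear_extend (F := E) Y)
  have := hc.preimage_mem_nhds (hP.mem_nhds (by simpa using h))
  filter_upwards [this] with y hy using ⟨_, _, hy⟩

end BaseCurvature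

/-! ### Orthonormal pairs of maximal fiber curvature -/

section MaximalPlane

variable {E : Type*} [NormedAddCommGroup E] [NormedSpace ℝ E] [FiniteDimensional ℝ E]
  {H : Type*} [TopologicalSpace H] {I : ModelWithCorners ℝ E H}
  {B : Type*} [TopologicalSpace B] [ChartedSpace H B]
  {F : Type*} [NormedAddCommGroup F] [NormedSpace ℝ F] [FiniteDimensional ℝ F]
  {V : B → Type*} [TopologicalSpace (TotalSpace F V)]
  [∀ x, NormedAddCommGroup (V x)] [∀ x, InnerProductSpace ℝ (V x)]
  [FiberBundle F V] [VectorBundle ℝ F V] [ContMDiffVectorBundle ∞ F V I]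
  [IsContMDiffRiemannianBundle I ∞ F V]

theorem orthonormal_pair_iff {U : Type*} [NormedAddCommGroup U] [InnerProductSpace ℝ U] {w u : U} :
    Orthonormal ℝ ![w, u] ↔ inner ℝ w w = 1 ∧ inner ℝ u u = 1 ∧ inner ℝ w u = 0 := by
  rw [orthonormal_iff_ite]
  simp [Fin.forall_fin_two, real_inner_comm w u]
  tauto

theorem orthonormal_pair_combination {ι U : Type*} [Fintype ι] [NormedAddCommGroup U]
    [InnerProductSpace ℝ U] {e : ι → U} (he : Orthonormal ℝ e) (a b : EuclideanSpace ℝ ι) :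
    Orthonormal ℝ ![∑ i, a i • e i, ∑ i, b i • e i] ↔ Orthonormal ℝ ![a, b] := by
  have h (a b : EuclideanSpace ℝ ι) :
      inner ℝ (∑ i, a i • e i) (∑ i, b i • e i) = inner ℝ a b := by
    rw [he.inner_sum]
    simp [PiLp.inner_apply, mul_comm]
  simp only [orthonormal_pair_iff, h]

theorem isCompact_orthonormal_pairs (ι : Type*) [Fintype ι] :
    IsCompact {z : EuclideanSpace ℝ ι × EuclideanSpace ℝ ι | Orthonormal ℝ ![z.1, z.2]} := by
  refine Metric.isCompact_of_isClosed_isBounded ?_ ?_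
  · simp only [orthonormal_pair_iff, Set.ofPred_and]
    refine (isClosed_eq ?_ ?_).inter ((isClosed_eq ?_ ?_).inter (isClosed_eq ?_ ?_)) <;> fun_prop
  · refine (Metric.isBounded_closedBall (x := 0) (r := 1)).subset fun z hz => ?_
    have h1 : ‖z.1‖ = 1 := hz.1 0
    have h2 : ‖z.2‖ = 1 := hz.1 1
    simp [Prod.norm_def, h1, h2]

theorem FiberCurvature.isSmoothTensor (Rf : FiberCurvature I F V) [IsManifold I ∞ B] (x : B) :
    IsSmoothTensor I F (fun y a b c d => Rf.toFun y a b c d) x where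
  lin y := by constructor <;> intros <;> simp
  smooth h₁ h₂ h₃ h₄ := by
    filter_upwards [h₁, h₂, h₃, h₄] with y k₁ k₂ k₃ k₄
    exact Rf.smooth y _ _ _ _ k₁ k₂ k₃ k₄

/-- In a frame the value is a polynomial in the coordinates whose coefficients are continuous on the
base. This gives joint continuity without a topology on the bundle of pairs. -/
theorem FiberCurvature.continuousAt_frame (Rf : FiberCurvature I F V) {ι : Type*} [Fintype ι]
    {e : ι → Π y, V y} {z : B × EuclideanSpace ℝ ι × EuclideanSpace ℝ ι} [IsManifold I ∞ B]
    (he : ∀ i, SmoothNear I F (e i) z.1) :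
    ContinuousAt (fun z : B × EuclideanSpace ℝ ι × EuclideanSpace ℝ ι =>
      Rf.toFun z.1 (∑ i, z.2.1 i • e i z.1) (∑ i, z.2.2 i • e i z.1) (∑ i, z.2.1 i • e i z.1)
        (∑ i, z.2.2 i • e i z.1)) z := by
  simp only [map_sum, map_smul, LinearMap.sum_apply, LinearMap.smul_apply, smul_eq_mul]
  have h (i j k l) : ContinuousAt (fun z : B × EuclideanSpace ℝ ι × EuclideanSpace ℝ ι =>
      Rf.toFun z.1 (e i z.1) (e j z.1) (e k z.1) (e l z.1)) z :=
    ((Rf.isSmoothTensor z.1).smooth (he i) (he j) (he k)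
      (he l)).contMDiffAt.continuousAt.comp (x := z) continuousAt_fst
  fun_prop

/-- An orthonormal frame over a compact neighbourhood `N` of `p` identifies the orthonormal pairs
over `N ∩ K` with a product of two compact sets. -/
theorem exists_local_max [LocallyCompactSpace B] [IsManifold I ∞ B] (hF : 2 ≤ Module.finrank ℝ F)
    (Rf : FiberCurvature I F V) {K : Set B} (hK : IsClosed K) {p : B} (hp : p ∈ K) :
    ∃ t ∈ 𝓝[K] p, ∃ q ∈ K, ∃ W U : V q, Orthonormal ℝ ![W, U] ∧
      ∀ y ∈ t, ∀ w u : V y, Orthonormal ℝ ![w, u] →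
        Rf.toFun y w u w u ≤ Rf.toFun q W U W U := by
  obtain ⟨k, hk, e, he, ho⟩ : ∃ k : ℕ, 2 ≤ k ∧ ∃ e : Fin k → Π y, V y,
      (∀ i, SmoothNear I F (e i) p) ∧ ∀ᶠ y in 𝓝 p, Orthonormal ℝ (fun i => e i y) ∧
        ∀ v : V y, v = ∑ i, inner ℝ (e i y) v • e i y :=
    ⟨_, hF, exists_orthonormal_frame (I := I) (F := F) (V := V) p⟩
  have hnear : ∀ᶠ y in 𝓝 p, (∀ i, SmoothNear I F (e i) y) ∧
      Orthonormal ℝ (fun i => e i y) ∧ ∀ v : V y, v = ∑ i, inner ℝ (e i y) v • e i y :=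
    (Filter.eventually_all.2 fun i => (he i).eventually).and ho
  obtain ⟨N, hN, hNsub, hNc⟩ := local_compact_nhds hnear
  let S := {z : EuclideanSpace ℝ (Fin k) ×
    EuclideanSpace ℝ (Fin k) | Orthonormal ℝ ![z.1, z.2]}
  let Q : B × EuclideanSpace ℝ (Fin k) ×
      EuclideanSpace ℝ (Fin k) → ℝ := fun z =>
    Rf.toFun z.1 (∑ i, z.2.1 i • e i z.1) (∑ i, z.2.2 i • e i z.1) (∑ i, z.2.1 i • e i z.1)
      (∑ i, z.2.2 i • e i z.1)
  have hQc : ContinuousOn Q ((N ∩ K) ×ˢ S) := fun z hz =>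
    (Rf.continuousAt_frame (hNsub hz.1.1).1).continuousWithinAt
  have hpN : p ∈ N := mem_of_mem_nhds hN
  have hSne : S.Nonempty := by
    refine ⟨(EuclideanSpace.single ⟨0, by omega⟩ 1, EuclideanSpace.single ⟨1, by omega⟩ 1), ?_⟩
    rw [Set.mem_ofPred_eq, orthonormal_pair_iff]
    refine ⟨by simp, by simp, ?_⟩
    rw [EuclideanSpace.inner_single_left]
    simp
  obtain ⟨⟨q, a, b⟩, hz, hmax⟩ := ((hNc.inter_right hK).prod
    (isCompact_orthonormal_pairs _)).exists_isMaxOn (Set.Nonempty.prod ⟨p, hpN, hp⟩ hSne) hQc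
  refine ⟨N ∩ K, Filter.inter_mem (mem_nhdsWithin_of_mem_nhds hN) self_mem_nhdsWithin, q, hz.1.2,
    ∑ i, a i • e i q, ∑ i, b i • e i q,
    (orthonormal_pair_combination (hNsub hz.1.1).2.1 a b).2 hz.2, fun y hy w u hwu => ?_⟩
  obtain ⟨-, hoy, hexp⟩ := hNsub hy.1
  let c : EuclideanSpace ℝ (Fin k) := WithLp.toLp 2 fun i => inner ℝ (e i y) w
  let d : EuclideanSpace ℝ (Fin k) := WithLp.toLp 2 fun i => inner ℝ (e i y) u
  have hc : w = ∑ i, c i • e i y := hexp w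
  have hd : u = ∑ i, d i • e i y := hexp u
  have hcd : (c, d) ∈ S := (orthonormal_pair_combination hoy c d).1 (by rwa [← hc, ← hd])
  have hle : Q (y, c, d) ≤ Q (q, a, b) := isMaxOn_iff.1 hmax (y, c, d) (Set.mk_mem_prod hy hcd)
  have h1 : Q (y, c, d) = Rf.toFun y w u w u := by
    simp only [Q, ← hc, ← hd]
  rw [← h1]
  exact hle

/-- On a nonempty compact set, some orthonormal pair maximises the fiber curvature. -/
theorem exists_max [LocallyCompactSpace B] [T2Space B] [IsManifold I ∞ B]
    (hF : 2 ≤ Module.finrank ℝ F)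
    (Rf : FiberCurvature I F V) {K : Set B} (hK : IsCompact K) (hne : K.Nonempty) :
    ∃ q ∈ K, ∃ W U : V q, Orthonormal ℝ ![W, U] ∧ ∀ y ∈ K, ∀ w u : V y, Orthonormal ℝ ![w, u] →
        Rf.toFun y w u w u ≤ Rf.toFun q W U W U := by
  -- Compactness induction on "some pair over `K` dominates all pairs over `t`". The dominating pair
  -- may lie outside `t`, so the property passes to subsets, and to unions by taking the larger
  -- value.
  refine hK.induction_on (p := fun t => ∃ q ∈ K, ∃ W U : V q, Orthonormal ℝ ![W, U] ∧
    ∀ y ∈ t, ∀ w u : V y, Orthonormal ℝ ![w, u] → Rf.toFun y w u w u ≤ Rf.toFun q W U W U)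
    ?_ ?_ ?_ ?_
  · obtain ⟨p, hp⟩ := hne
    obtain ⟨-, -, q, hq, W, U, h, -⟩ := exists_local_max hF Rf hK.isClosed hp
    exact ⟨q, hq, W, U, h, by simp⟩
  · rintro s t hst ⟨q, hq, W, U, h, hm⟩
    exact ⟨q, hq, W, U, h, fun y hy => hm y (hst hy)⟩
  · rintro s t ⟨q, hq, W, U, h, hm⟩ ⟨q', hq', W', U', h', hm'⟩
    rcases le_total (Rf.toFun q W U W U) (Rf.toFun q' W' U' W' U') with hle | hle
    · refine ⟨q', hq', W', U', h', fun y hy w u hwu => ?_⟩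
      rcases hy with hy | hy
      exacts [(hm y hy w u hwu).trans hle, hm' y hy w u hwu]
    · refine ⟨q, hq, W, U, h, fun y hy w u hwu => ?_⟩
      rcases hy with hy | hy
      exacts [hm y hy w u hwu, (hm' y hy w u hwu).trans hle]
  · intro p hp
    exact exists_local_max hF Rf hK.isClosed hp

end MaximalPlane

/-! ### Derivative tests along vector fields -/

section SecondDerivativeTest

variable {E : Type*} [NormedAddCommGroup E] [NormedSpace ℝ E] [CompleteSpace E]
  {H : Type*} [TopologicalSpace H] {I : ModelWithCorners ℝ E H}
  {B : Type*} [TopologicalSpace B] [ChartedSpace H B] [IsManifold I ∞ B]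
  {X : Π x : B, TangentSpace I x} {u h : B → ℝ} {p : B}

theorem hasDerivAt_comp_integralCurve {γ : ℝ → B} {t : ℝ}
    (hγ : HasMFDerivAt 𝓘(ℝ, ℝ) I γ t ((1 : ℝ →L[ℝ] ℝ).smulRight (X (γ t))))
    (hu : MDiffAt u (γ t)) :
    HasDerivAt (u ∘ γ) (mvfderiv I u (γ t) (X (γ t))) t := by
  have h1 := hu.hasMFDerivAt.comp t hγ
  rw [hasMFDerivAt_iff_hasFDerivAt] at h1
  obtain ⟨L, hL, hL1⟩ : ∃ L : ℝ →L[ℝ] ℝ, HasFDerivAt (u ∘ γ) L t ∧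
      L 1 = mfderiv I 𝓘(ℝ, ℝ) u (γ t) ((1 : ℝ) • X (γ t)) := ⟨_, h1, rfl⟩
  rw [one_smul] at hL1
  exact hL.hasDerivAt.congr_deriv hL1

/-- An integral curve of `X` turns derivatives along `X`, also iterated ones, into ordinary
derivatives in `t`. -/
theorem exists_curve [BoundarylessManifold I B] (hX : SmoothNear I E X p) :
    ∃ γ : ℝ → B, γ 0 = p ∧ ContinuousAt γ 0 ∧ ∀ u : B → ℝ, SmoothFunNear I u p →
      ∀ᶠ t in 𝓝 0, HasDerivAt (u ∘ γ) (mvfderiv I u (γ t) (X (γ t))) t := by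
  have : IsManifold I 1 B := .of_le (n := ∞) (by simp)
  obtain ⟨γ, h0, hγ⟩ := exists_isMIntegralCurveAt_of_contMDiffAt_boundaryless (I := I) (v := X)
    (x₀ := p) (t₀ := 0) (hX.contMDiffAt.of_le (by simp) :
      ContMDiffAt I I.tangent 1 (fun x => (⟨x, X x⟩ : TangentBundle I B)) p)
  have hc : ContinuousAt γ 0 := hγ.self_of_nhds.continuousAt
  refine ⟨γ, h0, hc, fun u hu => ?_⟩
  have hu' : ∀ᶠ t in 𝓝 0, SmoothFunNear I u (γ t) := by
    have := hc.tendsto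
    rw [h0] at this
    exact this.eventually hu.eventually
  filter_upwards [hγ, hu'] with t ht hut
  exact hasDerivAt_comp_integralCurve ht hut.mdiff

theorem mvfderiv_apply_eq_zero_of_isLocalMax [BoundarylessManifold I B]
    (hX : SmoothNear I E X p) (hh : SmoothFunNear I h p) (hmax : IsLocalMax h p) :
    mvfderiv I h p (X p) = 0 := by
  obtain ⟨γ, h0, hc, hd⟩ := exists_curve hX
  have hm : IsLocalMax (h ∘ γ) 0 := by
    have := hc.tendsto
    rw [h0] at this
    filter_upwards [this.eventually hmax] with t ht
    simpa [h0] using ht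
  have := hm.hasDerivAt_eq_zero (hd h hh).self_of_nhds
  rwa [h0] at this

/-- The second derivative along a vector field is nonpositive at a local maximum. -/
theorem mvfderiv_mvfderiv_nonpos [BoundarylessManifold I B]
    (hX : SmoothNear I E X p) (hh : SmoothFunNear I h p) (hmax : IsLocalMax h p) :
    mvfderiv I (fun y => mvfderiv I h y (X y)) p (X p) ≤ 0 := by
  obtain ⟨γ, h0, hc, hd⟩ := exists_curve hX
  have hm : IsLocalMax (h ∘ γ) 0 := by
    have := hc.tendsto
    rw [h0] at this
    filter_upwards [this.eventually hmax] with t ht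
    simpa [h0] using ht
  have h1 : deriv (h ∘ γ) =ᶠ[𝓝 0] (fun y => mvfderiv I h y (X y)) ∘ γ :=
    (hd h hh).mono fun t ht => ht.deriv
  have h2 : deriv (deriv (h ∘ γ)) 0 = mvfderiv I (fun y => mvfderiv I h y (X y)) p (X p) := by
    rw [h1.deriv_eq, (hd _ (hh.mvfderiv_apply hX)).self_of_nhds.deriv, h0]
  by_contra! hpos
  rw [← h2] at hpos
  -- A positive second derivative would make the local maximum also a local minimum. The function
  -- would then be locally constant, with second derivative zero.
  have hmin : IsLocalMin (h ∘ γ) 0 := isLocalMin_of_deriv_deriv_pos hpos hm.deriv_eq_zero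
    (hd h hh).self_of_nhds.continuousAt
  have hconst : h ∘ γ =ᶠ[𝓝 0] fun _ => (h ∘ γ) 0 := by
    filter_upwards [hm, hmin] with t ht1 ht2 using le_antisymm ht1 ht2
  have h3 : deriv (h ∘ γ) =ᶠ[𝓝 0] fun _ => 0 := by
    filter_upwards [hconst.eventually_nhds] with t ht
    rw [Filter.EventuallyEq.deriv_eq ht, deriv_const]
  rw [h3.deriv_eq, deriv_const] at hpos
  exact lt_irrefl _ hpos

theorem mvfderiv_congr {f g : B → ℝ} (e : ∀ᶠ y in 𝓝 p, f y = g y) :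
    mvfderiv I f p = mvfderiv I g p := by
  have h : mfderiv I 𝓘(ℝ, ℝ) f p = mfderiv I 𝓘(ℝ, ℝ) g p := Filter.EventuallyEq.mfderiv_eq e
  ext v
  simp only [mvfderiv, ContinuousLinearMap.comp_apply]
  rw [h]
  rfl

/-- Compose a chart, whose differential is invertible, with a functional equal to one on the image
of `c`. Such `f` serve to correct derivatives of sections. -/
theorem exists_fun_mvfderiv_eq_one {c : TangentSpace I p} (hc : c ≠ 0) :
    ∃ f : B → ℝ, SmoothFunNear I f p ∧ f p = 0 ∧ mvfderiv I f p c = 1 := by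
  have : IsManifold I 1 B := .of_le (n := ∞) (by simp)
  have hinv := isInvertible_mfderiv_extChartAt (I := I) (mem_extChartAt_source (I := I) p)
  obtain ⟨z, hz⟩ : ∃ z : E, z = mfderiv I 𝓘(ℝ, E) (extChartAt I p) p c := ⟨_, rfl⟩
  have hc' : z ≠ 0 := fun h0 => hc (by
    obtain ⟨e, he⟩ := hinv
    rw [h0, ← he] at hz
    exact e.injective (hz.symm.trans (map_zero e).symm))
  obtain ⟨l, hl⟩ := SeparatingDual.exists_eq_one (R := ℝ) hc'
  rw [hz] at hl
  have hs : SmoothFunNear I (fun y => l (extChartAt I p y)) p := by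
    filter_upwards [chart_source_mem_nhds H p] with y hy
    exact l.contMDiff.contMDiffAt.comp y (contMDiffAt_extChartAt' hy)
  refine ⟨fun y => l (extChartAt I p y) - l (extChartAt I p p), hs.sub (smoothFunNear_const _),
    sub_self _, ?_⟩
  rw [mvfderiv_fun_sub hs.mdiff mdifferentiableAt_const, mvfderiv_const, sub_zero]
  have hd : HasMFDerivAt I 𝓘(ℝ, ℝ) (l ∘ extChartAt I p) p
      (l ∘L mfderiv I 𝓘(ℝ, E) (extChartAt I p) p) :=
    HasMFDerivAt.comp p l.hasMFDerivAt
      (mdifferentiableAt_extChartAt (mem_chart_source H p)).hasMFDerivAt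
  have h2 := hd.mfderiv
  simp only [mvfderiv, ContinuousLinearMap.comp_apply]
  change (mfderiv I 𝓘(ℝ, ℝ) (l ∘ extChartAt I p) p) c = 1
  rw [h2]
  exact hl

/-- The first and second derivatives of `f` along `X` vanish at `p`. -/
structure IsFlatAlong (X : Π x : B, TangentSpace I x) (p : B) (f : B → ℝ) : Prop where
  smooth : SmoothFunNear I f p
  first : mvfderiv I f p (X p) = 0
  second : mvfderiv I (fun y => mvfderiv I f y (X y)) p (X p) = 0

/-- The only second-order term without a second derivative is a product of first derivatives, which
vanish. -/
theorem IsFlatAlong.mul {f g : B → ℝ} (hX : SmoothNear I E X p) (hf : IsFlatAlong X p f)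
    (hg : IsFlatAlong X p g) : IsFlatAlong X p (fun y => f y * g y) where
  smooth := hf.smooth.mul hg.smooth
  first := by
    simp [mvfderiv_fun_mul hf.smooth.mdiff hg.smooth.mdiff, hf.first, hg.first]
  second := by
    have e : ∀ᶠ y in 𝓝 p, mvfderiv I (fun y => f y * g y) y (X y)
        = f y * mvfderiv I g y (X y) + g y * mvfderiv I f y (X y) := by
      filter_upwards [hf.smooth.eventually, hg.smooth.eventually] with y h1 h2
      simp [mvfderiv_fun_mul h1.mdiff h2.mdiff]
    have hf' := hf.smooth.mvfderiv_apply hX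
    have hg' := hg.smooth.mvfderiv_apply hX
    rw [mvfderiv_congr e, mvfderiv_fun_add (hf.smooth.mul hg').mdiff (hg.smooth.mul hf').mdiff,
      mvfderiv_fun_mul hf.smooth.mdiff hg'.mdiff, mvfderiv_fun_mul hg.smooth.mdiff hf'.mdiff]
    simp [hf.first, hg.first, hf.second, hg.second]

theorem IsFlatAlong.sub {f g : B → ℝ} (hX : SmoothNear I E X p) (hf : IsFlatAlong X p f)
    (hg : IsFlatAlong X p g) : IsFlatAlong X p (fun y => f y - g y) where
  smooth := hf.smooth.sub hg.smooth
  first := by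
    simp [mvfderiv_fun_sub hf.smooth.mdiff hg.smooth.mdiff, hf.first, hg.first]
  second := by
    have e : ∀ᶠ y in 𝓝 p, mvfderiv I (fun y => f y - g y) y (X y)
        = mvfderiv I f y (X y) - mvfderiv I g y (X y) := by
      filter_upwards [hf.smooth.eventually, hg.smooth.eventually] with y h1 h2
      simp [mvfderiv_fun_sub h1.mdiff h2.mdiff]
    rw [mvfderiv_congr e, mvfderiv_fun_sub (hf.smooth.mvfderiv_apply hX).mdiff
      (hg.smooth.mvfderiv_apply hX).mdiff]
    simp [hf.second, hg.second]

theorem isFlatAlong_const (c : ℝ) : IsFlatAlong X p (fun _ => c) where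
  smooth := smoothFunNear_const c
  first := by simp [mvfderiv_const]
  second := by simp [mvfderiv_const]

end SecondDerivativeTest

/-! ### Sections flat to second order -/

section FlatSections

variable {E : Type*} [NormedAddCommGroup E] [NormedSpace ℝ E] [FiniteDimensional ℝ E]
  {H : Type*} [TopologicalSpace H] {I : ModelWithCorners ℝ E H}
  {B : Type*} [TopologicalSpace B] [T2Space B] [ChartedSpace H B] [IsManifold I ∞ B]
  {F : Type*} [NormedAddCommGroup F] [NormedSpace ℝ F]
  {V : B → Type*} [TopologicalSpace (TotalSpace F V)]
  [∀ x, AddCommGroup (V x)] [∀ x, Module ℝ (V x)] [∀ x, TopologicalSpace (V x)]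
  [∀ x, IsTopologicalAddGroup (V x)] [∀ x, ContinuousSMul ℝ (V x)]
  [FiberBundle F V] [VectorBundle ℝ F V]
  {D : CovariantDerivative I F V} {X : Π x : B, TangentSpace I x} {s t : Π x, V x} {p : B}

theorem covDeriv_sub (hs : SmoothNear I F s p) (ht : SmoothNear I F t p) :
    D (s - t) p = D s p - D t p := by
  have h := D.isCovariantDerivativeOnUniv.add (hs.sub ht).mdiff ht.mdiff
  rw [sub_add_cancel] at h
  rw [h, add_sub_cancel_right]

variable (D) in
/-- The section `s` is smooth near `p`, and its first and second covariant derivatives along `X`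
vanish at `p`. -/
structure IsFlatSection (X : Π x : B, TangentSpace I x) (p : B) (s : Π x, V x) : Prop where
  smooth : SmoothNear I F s p
  first : D s p (X p) = 0
  second : D (fun y => D s y (X y)) p (X p) = 0

variable [ContMDiffVectorBundle ∞ F V I]

/-- If `f(p) = 0` and `df(c) = 1`, subtracting `f` times an extension of `D_c s` removes the
derivative and keeps the value. -/
theorem exists_section_covDeriv_eq_zero (D : CovariantDerivative I F V) (c : TangentSpace I p)
    (v : V p) : ∃ s : Π x, V x, SmoothNear I F s p ∧ s p = v ∧ D s p c = 0 := by
  have e (v : V p) : SmoothNear I F (extend F v) p := smoothNear_extend v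
  by_cases hc : c = 0
  · exact ⟨extend F v, e v, by simp, by simp [hc]⟩
  obtain ⟨f, hf, hf0, hf1⟩ := exists_fun_mvfderiv_eq_one hc
  refine ⟨extend F v - f • extend F (D (extend F v) p c), (e _).sub ((e _).smul hf), ?_, ?_⟩
  · simp [hf0]
  · rw [covDeriv_sub (e _) ((e _).smul hf),
      D.isCovariantDerivativeOnUniv.leibniz (e _).mdiff hf.mdiff]
    simp [hf0, hf1]

/-- The remaining second derivative `z` is removed by subtracting `½ f² z`: at `p` this has zero
value, zero first derivative, and second derivative `(X f)² z = z`. -/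
theorem exists_flat_section (hD : PreservesSmooth D) (hX : SmoothNear I E X p) (h0 : X p ≠ 0)
    (v : V p) : ∃ s : Π x, V x, s p = v ∧ IsFlatSection D X p s := by
  obtain ⟨s, hs, hsv, hs1⟩ := exists_section_covDeriv_eq_zero D (X p) v
  obtain ⟨f, hf, hf0, hf1⟩ := exists_fun_mvfderiv_eq_one h0
  set z : Π x, V x := extend F (D (fun y => D s y (X y)) p (X p)) with hz
  have hzs : SmoothNear I F z p := smoothNear_extend _
  have hq : SmoothFunNear I (fun y => 2⁻¹ * (f y * f y)) p :=
    (smoothFunNear_const (2⁻¹)).mul (hf.mul hf)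
  have hq' : ∀ᶠ y in 𝓝 p, ∀ a, mvfderiv I (fun y => 2⁻¹ * (f y * f y)) y a
      = f y * mvfderiv I f y a := by
    filter_upwards [hf.eventually] with y hy a
    rw [mvfderiv_fun_mul (smoothFunNear_const (2⁻¹)).mdiff (hy.mul hy).mdiff,
      mvfderiv_fun_mul hy.mdiff hy.mdiff, mvfderiv_const]
    simp
    ring
  have hqz : SmoothNear I F ((fun y => 2⁻¹ * (f y * f y)) • z) p := hzs.smul hq
  have hXf := hf.mvfderiv_apply hX
  refine ⟨s - (fun y => 2⁻¹ * (f y * f y)) • z, by simp [hf0, hsv], hs.sub hqz, ?_, ?_⟩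
  · rw [covDeriv_sub hs hqz, D.isCovariantDerivativeOnUniv.leibniz hzs.mdiff hq.mdiff]
    simp [hs1, hf0, hq'.self_of_nhds]
  · have s1 : SmoothNear I F ((fun y => 2⁻¹ * (f y * f y)) • fun y => D z y (X y)) p :=
      SmoothNear.smul hq (hD hX hzs)
    have s2 : SmoothNear I F ((fun y => f y * mvfderiv I f y (X y)) • z) p :=
      SmoothNear.smul (hf.mul hXf) hzs
    have key : D (fun y => D (s - (fun y => 2⁻¹ * (f y * f y)) • z) y (X y)) p
        = D ((fun y => D s y (X y)) - (((fun y => 2⁻¹ * (f y * f y)) • fun y => D z y (X y))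
          + (fun y => f y * mvfderiv I f y (X y)) • z)) p := by
      refine D.isCovariantDerivativeOnUniv.congr_of_eventuallyEq (hD hX (hs.sub hqz)).mdiff
        ((hD hX hs).sub (s1.add s2)).mdiff Filter.univ_mem ?_
      filter_upwards [hs.eventually, hqz.eventually, hzs.eventually, hq.eventually, hq']
        with y h1 h2 h3 h4 h5
      rw [covDeriv_sub h1 h2, D.isCovariantDerivativeOnUniv.leibniz h3.mdiff h4.mdiff]
      simp [h5]
    rw [key, covDeriv_sub (hD hX hs) (s1.add s2),
      D.isCovariantDerivativeOnUniv.add s1.mdiff s2.mdiff,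
      D.isCovariantDerivativeOnUniv.leibniz (hD hX hzs).mdiff hq.mdiff,
      D.isCovariantDerivativeOnUniv.leibniz hzs.mdiff (hf.mul hXf).mdiff,
      mvfderiv_fun_mul hf.mdiff hXf.mdiff]
    simp [hf0, hf1, hq'.self_of_nhds, hz]

variable [FiniteDimensional ℝ F] {T : Π x : B, V x → V x → V x → V x → ℝ}
  {s₁ s₂ s₃ s₄ : Π x, V x}

/-- The second covariant derivative of a smooth tensor field, on flat sections. -/
theorem covDerivTensor_covDerivTensor_eq (hD : PreservesSmooth D)
    (hT : ∀ x, IsSmoothTensor I F T x) (hX : SmoothNear I E X p)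
    (h₁ : IsFlatSection D X p s₁) (h₂ : IsFlatSection D X p s₂)
    (h₃ : IsFlatSection D X p s₃) (h₄ : IsFlatSection D X p s₄) :
    covDerivTensor D (fun y => covDerivTensor D T y (X y)) p (X p) (s₁ p) (s₂ p) (s₃ p) (s₄ p)
      = mvfderiv I (fun y => mvfderiv I (fun y => T y (s₁ y) (s₂ y) (s₃ y) (s₄ y)) y (X y))
        p (X p) := by
  have hS := isSmoothTensor_covDerivTensor hD hT hX
  have L := (hS.lin p)
  have LT := (hT p).lin p
  have k₁ := hD hX h₁.smooth
  have k₂ := hD hX h₂.smooth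
  have k₃ := hD hX h₃.smooth
  have k₄ := hD hX h₄.smooth
  have LD := covDerivTensor_lin (D := D) (hT p) (X p)
  -- Since `D_X sᵢ` and its derivative along `X` vanish at `p`, so does the derivative along `X` of
  -- `T` with `D_X sᵢ` in slot `i`. These are the correction terms of the Leibniz formula.
  have z₁ := covDerivTensor_eq (D := D) (hT p) (X p) k₁ h₂.smooth h₃.smooth h₄.smooth
  have z₂ := covDerivTensor_eq (D := D) (hT p) (X p) h₁.smooth k₂ h₃.smooth h₄.smooth
  have z₃ := covDerivTensor_eq (D := D) (hT p) (X p) h₁.smooth h₂.smooth k₃ h₄.smooth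
  have z₄ := covDerivTensor_eq (D := D) (hT p) (X p) h₁.smooth h₂.smooth h₃.smooth k₄
  simp only [covDerivTensorOfSections, h₁.first, h₂.first, h₃.first, h₄.first, h₁.second,
    h₂.second, h₃.second, h₄.second, LD.zero₁, LD.zero₂, LD.zero₃, LD.zero₄, LT.zero₁, LT.zero₂,
    LT.zero₃, LT.zero₄, sub_zero] at z₁ z₂ z₃ z₄
  rw [covDerivTensor_eq hS (X p) h₁.smooth h₂.smooth h₃.smooth h₄.smooth]
  simp only [covDerivTensorOfSections, h₁.first, h₂.first, h₃.first, h₄.first, LD.zero₁, LD.zero₂,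
    LD.zero₃, LD.zero₄, sub_zero]
  have e : ∀ᶠ y in 𝓝 p, covDerivTensor D T y (X y) (s₁ y) (s₂ y) (s₃ y) (s₄ y)
      = covDerivTensorOfSections D T y (X y) s₁ s₂ s₃ s₄ := by
    filter_upwards [h₁.smooth.eventually, h₂.smooth.eventually, h₃.smooth.eventually,
      h₄.smooth.eventually] with y e₁ e₂ e₃ e₄
    exact covDerivTensor_eq (hT y) _ e₁ e₂ e₃ e₄
  have m₀ := ((hT p).smooth h₁.smooth h₂.smooth h₃.smooth h₄.smooth).mvfderiv_apply hX
  have m₁ := (hT p).smooth k₁ h₂.smooth h₃.smooth h₄.smooth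
  have m₂ := (hT p).smooth h₁.smooth k₂ h₃.smooth h₄.smooth
  have m₃ := (hT p).smooth h₁.smooth h₂.smooth k₃ h₄.smooth
  have m₄ := (hT p).smooth h₁.smooth h₂.smooth h₃.smooth k₄
  rw [mvfderiv_congr e]
  simp only [covDerivTensorOfSections]
  rw [mvfderiv_fun_sub (((m₀.sub m₁).sub m₂).sub m₃).mdiff m₄.mdiff,
    mvfderiv_fun_sub ((m₀.sub m₁).sub m₂).mdiff m₃.mdiff,
    mvfderiv_fun_sub (m₀.sub m₁).mdiff m₂.mdiff, mvfderiv_fun_sub m₀.mdiff m₁.mdiff]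
  simp [← z₁, ← z₂, ← z₃, ← z₄]

end FlatSections

/-! ### From orthonormal to arbitrary pairs -/

section FiberBound

variable {U : Type*} [NormedAddCommGroup U] [InnerProductSpace ℝ U]
  {R : U →ₗ[ℝ] U →ₗ[ℝ] U →ₗ[ℝ] U →ₗ[ℝ] ℝ} {m : ℝ}

theorem apply_le_of_inner_eq_zero (hm : ∀ w u, Orthonormal ℝ ![w, u] → R w u w u ≤ m) {w u : U}
    (h : inner ℝ w u = 0) : R w u w u ≤ m * (inner ℝ w w * inner ℝ u u) := by
  rcases eq_or_ne w 0 with rfl | hw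
  · simp
  rcases eq_or_ne u 0 with rfl | hu
  · simp
  have hw' : ‖w‖ ≠ 0 := norm_ne_zero_iff.2 hw
  have hu' : ‖u‖ ≠ 0 := norm_ne_zero_iff.2 hu
  have h1 := hm (‖w‖⁻¹ • w) (‖u‖⁻¹ • u) (orthonormal_pair_iff.2 ⟨by
    rw [real_inner_smul_left, real_inner_smul_right, real_inner_self_eq_norm_sq]; field_simp, by
    rw [real_inner_smul_left, real_inner_smul_right, real_inner_self_eq_norm_sq]; field_simp, by
    rw [real_inner_smul_left, real_inner_smul_right, h]; simp⟩)
  simp only [map_smul, LinearMap.smul_apply, smul_eq_mul] at h1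
  rw [real_inner_self_eq_norm_sq, real_inner_self_eq_norm_sq]
  calc R w u w u = (‖w‖ ^ 2 * ‖u‖ ^ 2) * (‖u‖⁻¹ * (‖w‖⁻¹ * (‖u‖⁻¹ * (‖w‖⁻¹ * R w u w u)))) := by
        field_simp
    _ ≤ (‖w‖ ^ 2 * ‖u‖ ^ 2) * m := mul_le_mul_of_nonneg_left (by convert h1 using 1)
        (by positivity)
    _ = _ := mul_comm _ _

/-- Replacing `u` by its component orthogonal to `w` changes neither `R(w,u,w,u)`, by the
antisymmetries, nor the Gram determinant. -/
theorem apply_le_of_orthonormal (hl : ∀ a b c d, R a b c d = -R b a c d)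
    (hr : ∀ a b c d, R a b c d = -R a b d c)
    (hm : ∀ w u, Orthonormal ℝ ![w, u] → R w u w u ≤ m) (w u : U) :
    R w u w u ≤ m * (inner ℝ w w * inner ℝ u u - inner ℝ w u * inner ℝ w u) := by
  rcases eq_or_ne w 0 with rfl | hw
  · simp
  have hw' : inner ℝ w w ≠ 0 := inner_self_ne_zero.2 hw
  set t : ℝ := inner ℝ w u / inner ℝ w w with ht
  have ht' : t * inner ℝ w w = inner ℝ w u := div_mul_cancel₀ _ hw'
  have h := apply_le_of_inner_eq_zero hm (w := w) (u := u - t • w) (by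
    rw [inner_sub_right, real_inner_smul_right, ht', sub_self])
  have z1 (c d : U) : R w w c d = 0 := by linarith [hl w w c d]
  have z2 (a b : U) : R a b w w = 0 := by linarith [hr a b w w]
  have e : R w (u - t • w) w (u - t • w) = R w u w u := by
    simp [z1, z2]
  have e2 : inner ℝ w w * inner ℝ (u - t • w) (u - t • w)
      = inner ℝ w w * inner ℝ u u - inner ℝ w u * inner ℝ w u := by
    simp only [inner_sub_left, inner_sub_right, real_inner_smul_left, real_inner_smul_right,
      real_inner_comm w u]
    linear_combination (t * inner ℝ w w - inner ℝ w u) * ht'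
  rwa [e, e2] at h

end FiberBound

/-! ### Skew forms in odd dimension -/

section OddKernel

theorem exists_vecMul_eq_zero_of_odd {ι : Type*} [Fintype ι] [DecidableEq ι]
    (hι : Odd (Fintype.card ι)) {M : Matrix ι ι ℝ} (hM : ∀ i j, M i j = -M j i) :
    ∃ x : ι → ℝ, x ≠ 0 ∧ Matrix.vecMul x M = 0 := by
  rw [Matrix.exists_vecMul_eq_zero_iff]
  have h : M = -M.transpose := by
    ext i j
    exact hM i j
  have h1 : M.det = -M.det := by
    conv_lhs => rw [h, Matrix.det_neg, hι.neg_one_pow, Matrix.det_transpose]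
    ring
  linarith

variable {E : Type*} [NormedAddCommGroup E] [NormedSpace ℝ E] [FiniteDimensional ℝ E]
  {H : Type*} [TopologicalSpace H] {I : ModelWithCorners ℝ E H}
  {B : Type*} [TopologicalSpace B] [T2Space B] [ChartedSpace H B] [IsManifold I ∞ B]
  {F : Type*} [NormedAddCommGroup F] [NormedSpace ℝ F] [FiniteDimensional ℝ F]
  {V : B → Type*} [TopologicalSpace (TotalSpace F V)]
  [∀ x, NormedAddCommGroup (V x)] [∀ x, InnerProductSpace ℝ (V x)]
  [FiberBundle F V] [VectorBundle ℝ F V] [ContMDiffVectorBundle ∞ F V I]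
  (g : ContMDiffRiemannianMetric I ∞ E (fun x : B => TangentSpace I x))
  {D : CovariantDerivative I F V} {p : B}

/-- The form `(X,Y) ↦ ⟨R(X,Y)W,U⟩` is skew, so its odd-sized matrix has determinant zero. A kernel
vector is expressed in the same basis as in the definition of `curvatureVector`. -/
theorem exists_curvatureVector_eq_zero (hE : Odd (Module.finrank ℝ E)) (hD : PreservesSmooth D)
    (W U : V p) : ∃ X : TangentSpace I p, X ≠ 0 ∧ curvatureVector g D W U X = 0 := by
  let b := Module.finBasis ℝ (TangentSpace I p)
  let φ (Y : TangentSpace I p) : TangentSpace I p →ₗ[ℝ] ℝ :=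
    { toFun := fun X => inner ℝ (curvature D X Y W) U
      map_add' := fun X X' => by rw [curvature_add_left hD, inner_add_left]
      map_smul' := fun r X => by
        rw [curvature_smul_left hD, real_inner_smul_left]
        rfl }
  obtain ⟨x, hx, h⟩ := exists_vecMul_eq_zero_of_odd (M := fun i j => φ (b j) (b i))
    (by rw [Fintype.card_fin]; exact hE) (fun i j => by
      change inner ℝ (curvature D _ _ W) U = -inner ℝ (curvature D _ _ W) U
      rw [curvature_swap, inner_neg_left])
  refine ⟨∑ i, x i • b i, fun h0 => hx ?_, ?_⟩
  · exact funext (Fintype.linearIndependent_iff.1 b.linearIndependent x h0)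
  · rw [curvatureVector, LinearEquiv.map_eq_zero_iff]
    refine b.ext fun j => ?_
    rw [Module.Basis.constr_basis]
    have := congrFun h j
    change φ (b j) (∑ i, x i • b i) = 0
    simpa [Matrix.vecMul, dotProduct] using this

end OddKernel

/-! ### Derivatives of the fiber curvature at a maximum -/

section Maximum

variable {E : Type*} [NormedAddCommGroup E] [NormedSpace ℝ E] [FiniteDimensional ℝ E]
  {H : Type*} [TopologicalSpace H] {I : ModelWithCorners ℝ E H}
  {B : Type*} [TopologicalSpace B] [T2Space B] [ChartedSpace H B] [IsManifold I ∞ B]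
  {F : Type*} [NormedAddCommGroup F] [NormedSpace ℝ F] [FiniteDimensional ℝ F]
  {V : B → Type*} [TopologicalSpace (TotalSpace F V)]
  [∀ x, NormedAddCommGroup (V x)] [∀ x, InnerProductSpace ℝ (V x)]
  [FiberBundle F V] [VectorBundle ℝ F V] [ContMDiffVectorBundle ∞ F V I]
  [IsContMDiffRiemannianBundle I ∞ F V]
  {g : ContMDiffRiemannianMetric I ∞ E (fun x : B => TangentSpace I x)}
  {D : CovariantDerivative I F V} {p : B} {X : Π x : B, TangentSpace I x} {s t : Π x, V x}

theorem mvfderiv_inner (hD : D.IsMetricCompatible) (c : TangentSpace I p)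
    (hs : SmoothNear I F s p) (ht : SmoothNear I F t p) :
    mvfderiv I (fun y => inner ℝ (s y) (t y)) p c
      = inner ℝ (D s p c) (t p) + inner ℝ (s p) (D t p c) := by
  simpa using hD.mvfderiv_inner_eq (extend E c) hs.mdiff ht.mdiff

theorem IsFlatSection.inner (hDs : PreservesSmooth D) (hD : D.IsMetricCompatible)
    (hX : SmoothNear I E X p) (hs : IsFlatSection D X p s) (ht : IsFlatSection D X p t) :
    IsFlatAlong X p (fun y => inner ℝ (s y) (t y)) where
  smooth := hs.smooth.inner ht.smooth
  first := by
    rw [mvfderiv_inner hD _ hs.smooth ht.smooth, hs.first, ht.first]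
    simp
  second := by
    have e : ∀ᶠ y in 𝓝 p, mvfderiv I (fun y => Inner.inner ℝ (s y) (t y)) y (X y)
        = Inner.inner ℝ (D s y (X y)) (t y) + Inner.inner ℝ (s y) (D t y (X y)) := by
      filter_upwards [hs.smooth.eventually, ht.smooth.eventually] with y h1 h2
      exact mvfderiv_inner hD _ h1 h2
    have ks := hDs hX hs.smooth
    have kt := hDs hX ht.smooth
    rw [mvfderiv_congr e, mvfderiv_fun_add (ks.inner ht.smooth).mdiff (hs.smooth.inner kt).mdiff,
      _root_.add_apply, mvfderiv_inner hD _ ks ht.smooth, mvfderiv_inner hD _ hs.smooth kt,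
      hs.first, ht.first, hs.second, ht.second]
    simp

variable {Rf : FiberCurvature I F V} {W U : V p}

variable (Rf) in
/-- The defect of the bound `m` for the fiber curvature on the pair of sections `s`, `t`. -/
def curvatureDefect (m : ℝ) (s t : Π x, V x) (y : B) : ℝ :=
  Rf.toFun y (s y) (t y) (s y) (t y) -
    m * (inner ℝ (s y) (s y) * inner ℝ (t y) (t y) - inner ℝ (s y) (t y) * inner ℝ (s y) (t y))

/-- The Gram factor makes the defect nonpositive near `p` although `s, t` need not stay orthonormal;
at `p` it is zero. -/
theorem isLocalMax_curvatureDefect (h : Orthonormal ℝ ![s p, t p])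
    (hmax : ∀ᶠ y in 𝓝 p, ∀ w u : V y, Orthonormal ℝ ![w, u] →
      Rf.toFun y w u w u ≤ Rf.toFun p (s p) (t p) (s p) (t p)) :
    IsLocalMax (curvatureDefect Rf (Rf.toFun p (s p) (t p) (s p) (t p)) s t) p := by
  obtain ⟨h1, h2, h3⟩ := orthonormal_pair_iff.1 h
  filter_upwards [hmax] with y hy
  have h0 : curvatureDefect Rf (Rf.toFun p (s p) (t p) (s p) (t p)) s t p = 0 := by
    simp only [curvatureDefect, h1, h2, h3]
    ring
  rw [h0]
  exact sub_nonpos.2 (apply_le_of_orthonormal (Rf.antisymm_left y) (Rf.antisymm_right y) hy _ _)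

/-- First-order condition, tested on sections with `D_c s = D_c t = 0`, for which the Gram
determinant has zero derivative too. -/
theorem covDerivTensor_eq_zero_of_max [BoundarylessManifold I B]
    (hDm : D.IsMetricCompatible) (h : Orthonormal ℝ ![W, U])
    (hmax : ∀ᶠ y in 𝓝 p, ∀ w u : V y, Orthonormal ℝ ![w, u] →
      Rf.toFun y w u w u ≤ Rf.toFun p W U W U) (c : TangentSpace I p) :
    covDerivTensor D (fun y a b c d => Rf.toFun y a b c d) p c W U W U = 0 := by
  have : CompleteSpace E := FiniteDimensional.complete ℝ E
  obtain ⟨s, hs, rfl, hsc⟩ := exists_section_covDeriv_eq_zero D c W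
  obtain ⟨t, ht, rfl, htc⟩ := exists_section_covDeriv_eq_zero D c U
  set m := Rf.toFun p (s p) (t p) (s p) (t p) with hm
  have hT := (Rf.isSmoothTensor p).smooth hs ht hs ht
  have hss := hs.inner hs
  have hst := hs.inner ht
  have htt := ht.inner ht
  have hG := (hss.mul htt).sub (hst.mul hst)
  have h1 := mvfderiv_apply_eq_zero_of_isLocalMax (smoothNear_extend (F := E) c)
    (hT.sub ((smoothFunNear_const m).mul hG)) (isLocalMax_curvatureDefect h hmax)
  rw [extend_apply_self, mvfderiv_fun_sub hT.mdiff ((smoothFunNear_const m).mul hG).mdiff,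
    mvfderiv_fun_mul (smoothFunNear_const m).mdiff hG.mdiff,
    mvfderiv_fun_sub (hss.mul htt).mdiff (hst.mul hst).mdiff,
    mvfderiv_fun_mul hss.mdiff htt.mdiff, mvfderiv_fun_mul hst.mdiff hst.mdiff, mvfderiv_const] at h1
  have z₁ : mvfderiv I (fun y => inner ℝ (s y) (s y)) p c = 0 := by
    rw [mvfderiv_inner hDm c hs hs, hsc, inner_zero_left, inner_zero_right, add_zero]
  have z₂ : mvfderiv I (fun y => inner ℝ (s y) (t y)) p c = 0 := by
    rw [mvfderiv_inner hDm c hs ht, hsc, htc, inner_zero_left, inner_zero_right, add_zero]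
  have z₃ : mvfderiv I (fun y => inner ℝ (t y) (t y)) p c = 0 := by
    rw [mvfderiv_inner hDm c ht ht, htc, inner_zero_left, inner_zero_right, add_zero]
  simp only [_root_.add_apply, _root_.sub_apply, _root_.smul_apply, z₁, z₂, z₃, smul_zero,
    add_zero, sub_zero] at h1
  have L := (Rf.isSmoothTensor p).lin p
  rw [covDerivTensor_eq (Rf.isSmoothTensor p) c hs ht hs ht]
  simp only [covDerivTensorOfSections, hsc, htc]
  simpa using h1

/-- Where the fiber curvature is maximal among orthonormal pairs of nearby fibers, its second
covariant derivatives are nonpositive. -/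
theorem secondDerivFiberCurvature_nonpos_of_max [BoundarylessManifold I B]
    (hD : PreservesSmooth D) (hDm : D.IsMetricCompatible) (h : Orthonormal ℝ ![W, U])
    (hmax : ∀ᶠ y in 𝓝 p, ∀ w u : V y, Orthonormal ℝ ![w, u] →
      Rf.toFun y w u w u ≤ Rf.toFun p W U W U) {X : TangentSpace I p} (hX : X ≠ 0) :
    secondDerivFiberCurvature g D Rf X W U ≤ 0 := by
  have : CompleteSpace E := FiniteDimensional.complete ℝ E
  -- The correction `D_{∇_X X}` vanishes by the first-order condition, so the extension of `X` need
  -- not be geodesic.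
  rw [secondDerivFiberCurvature, secondCovDerivTensor, covDerivTensor_eq_zero_of_max hDm h hmax,
    sub_zero]
  have hXs : SmoothNear I E (extend E X) p := smoothNear_extend X
  have hX0 : extend E X p = X := by simp
  obtain ⟨s, rfl, hs⟩ := exists_flat_section hD hXs (by rwa [hX0]) W
  obtain ⟨t, rfl, ht⟩ := exists_flat_section hD hXs (by rwa [hX0]) U
  have key := covDerivTensor_covDerivTensor_eq hD (fun x => Rf.isSmoothTensor x) hXs hs ht hs ht
  rw [hX0] at key
  rw [key]
  set m := Rf.toFun p (s p) (t p) (s p) (t p) with hm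
  have hT := (Rf.isSmoothTensor p).smooth hs.smooth ht.smooth hs.smooth ht.smooth
  have hst := hs.inner hD hDm hXs ht
  -- The Gram term is flat along `X`, so the defect and the fiber curvature have the same second
  -- derivative.
  have hG := (isFlatAlong_const m).mul hXs
    (((hs.inner hD hDm hXs hs).mul hXs (ht.inner hD hDm hXs ht)).sub hXs (hst.mul hXs hst))
  have h2 := mvfderiv_mvfderiv_nonpos hXs (hT.sub hG.smooth) (isLocalMax_curvatureDefect h hmax)
  have e : ∀ᶠ y in 𝓝 p, mvfderiv I (fun y => Rf.toFun y (s y) (t y) (s y) (t y) - m *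
      (inner ℝ (s y) (s y) * inner ℝ (t y) (t y) - inner ℝ (s y) (t y) * inner ℝ (s y) (t y))) y
        (extend E X y)
      = mvfderiv I (fun y => Rf.toFun y (s y) (t y) (s y) (t y)) y (extend E X y)
        - mvfderiv I (fun y => m * (inner ℝ (s y) (s y) * inner ℝ (t y) (t y)
          - inner ℝ (s y) (t y) * inner ℝ (s y) (t y))) y (extend E X y) := by
    filter_upwards [hT.eventually, hG.smooth.eventually] with y h1 h2
    rw [mvfderiv_fun_sub h1.mdiff h2.mdiff]
    rfl
  rw [mvfderiv_congr e, mvfderiv_fun_sub (hT.mvfderiv_apply hXs).mdiff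
    (hG.smooth.mvfderiv_apply hXs).mdiff, _root_.sub_apply, hG.second, sub_zero, hX0] at h2
  exact h2

/-- On a nonempty compact open set, some orthonormal pair in a fiber has nonpositive second
derivatives of the fiber curvature, in a direction that its curvature vector vanishes in. -/
theorem exists_curvatureVector_eq_zero_and_nonpos [BoundarylessManifold I B]
    [LocallyCompactSpace B] (hE : Odd (Module.finrank ℝ E)) (hF : 2 ≤ Module.finrank ℝ F)
    (hD : PreservesSmooth D) (hDm : D.IsMetricCompatible) (Rf : FiberCurvature I F V)
    {K : Set B} (hK : IsCompact K) (hKo : IsOpen K) (hne : K.Nonempty) :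
    ∃ q ∈ K, ∃ W U : V q, Orthonormal ℝ ![W, U] ∧ ∃ X : TangentSpace I q, X ≠ 0 ∧
      curvatureVector g D W U X = 0 ∧ secondDerivFiberCurvature g D Rf X W U ≤ 0 := by
  obtain ⟨q, hq, W, U, h, hmax⟩ := exists_max hF Rf hK hne
  obtain ⟨X, hX, hX0⟩ := exists_curvatureVector_eq_zero g hE hD W U
  refine ⟨q, hq, W, U, h, X, hX, hX0, secondDerivFiberCurvature_nonpos_of_max hD hDm h ?_ hX⟩
  -- Openness of `K` makes the maximum over `K` a local maximum in `B`.
  filter_upwards [hKo.mem_nhds hq] with y hy using hmax y hy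

end Maximum

/-! ### Reversing the sign of the fiber curvature -/

section Neg

variable {E : Type*} [NormedAddCommGroup E] [NormedSpace ℝ E] [FiniteDimensional ℝ E]
  {H : Type*} [TopologicalSpace H] {I : ModelWithCorners ℝ E H}
  {B : Type*} [TopologicalSpace B] [ChartedSpace H B] [IsManifold I ∞ B]
  {F : Type*} [NormedAddCommGroup F] [NormedSpace ℝ F]
  {V : B → Type*} [TopologicalSpace (TotalSpace F V)]
  [∀ x, NormedAddCommGroup (V x)] [∀ x, InnerProductSpace ℝ (V x)]
  [FiberBundle F V]

theorem mvfderiv_neg_apply (f : B → ℝ) (x : B) (a : TangentSpace I x) :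
    mvfderiv I (fun y => -f y) x a = -mvfderiv I f x a := by
  rw [mvfderiv_fun_neg]
  rfl

theorem covDerivTensor_neg (D : CovariantDerivative I F V)
    (T : Π x : B, V x → V x → V x → V x → ℝ) (x : B) (a : TangentSpace I x) (w₁ w₂ w₃ w₄ : V x) :
    covDerivTensor D (fun y a b c d => -T y a b c d) x a w₁ w₂ w₃ w₄
      = -covDerivTensor D T x a w₁ w₂ w₃ w₄ := by
  simp only [covDerivTensor, mvfderiv_neg_apply]
  ring

/-- Turns minima of `k^f` into maxima, for use where the base is negatively curved. -/
instance : Neg (FiberCurvature I F V) where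
  neg Rf :=
    { toFun := fun x => (-1 : ℝ) • Rf.toFun x
      antisymm_left := fun x a b c d => by
        simp only [LinearMap.smul_apply, smul_eq_mul]
        linarith [Rf.antisymm_left x a b c d]
      antisymm_right := fun x a b c d => by
        simp only [LinearMap.smul_apply, smul_eq_mul]
        linarith [Rf.antisymm_right x a b c d]
      bianchi := fun x a b c d => by
        simp only [LinearMap.smul_apply, smul_eq_mul]
        linarith [Rf.bianchi x a b c d]
      smooth := fun x _ _ _ _ h₁ h₂ h₃ h₄ => by
        simpa using (Rf.smooth x _ _ _ _ h₁ h₂ h₃ h₄).neg }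

theorem secondDerivFiberCurvature_neg
    (g : ContMDiffRiemannianMetric I ∞ E (fun x : B => TangentSpace I x))
    (D : CovariantDerivative I F V) (Rf : FiberCurvature I F V) {p : B} (X : TangentSpace I p)
    (W U : V p) :
    secondDerivFiberCurvature g D (-Rf) X W U = -secondDerivFiberCurvature g D Rf X W U := by
  have e : (fun x a b c d => (-Rf).toFun x a b c d) = fun x a b c d => -Rf.toFun x a b c d := by
    funext x a b c d
    exact neg_one_mul _
  have e' (b : TangentSpace I p) :
      (fun y => covDerivTensor D (fun x a b c d => -Rf.toFun x a b c d) y (extend E b y))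
        = fun y w₁ w₂ w₃ w₄ => -covDerivTensor D (fun x a b c d => Rf.toFun x a b c d) y
          (extend E b y) w₁ w₂ w₃ w₄ := by
    funext y w₁ w₂ w₃ w₄
    exact covDerivTensor_neg _ _ _ _ _ _ _ _
  simp only [secondDerivFiberCurvature, secondCovDerivTensor]
  rw [e, e', covDerivTensor_neg, covDerivTensor_neg]
  ring

end Neg

/-! ### The contradiction -/

section MainTheorem

variable {E : Type*} [NormedAddCommGroup E] [NormedSpace ℝ E] [FiniteDimensional ℝ E]
  {H : Type*} [TopologicalSpace H] {I : ModelWithCorners ℝ E H}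
  {B : Type*} [TopologicalSpace B] [T2Space B] [ChartedSpace H B] [IsManifold I ∞ B]
  {F : Type*} [NormedAddCommGroup F] [NormedSpace ℝ F] [FiniteDimensional ℝ F]
  {V : B → Type*} [TopologicalSpace (TotalSpace F V)]
  [∀ x, NormedAddCommGroup (V x)] [∀ x, InnerProductSpace ℝ (V x)]
  [FiberBundle F V] [VectorBundle ℝ F V] [ContMDiffVectorBundle ∞ F V I]
  [IsContMDiffRiemannianBundle I ∞ F V]
  {g : ContMDiffRiemannianMetric I ∞ E (fun x : B => TangentSpace I x)}
  {D : CovariantDerivative I F V} {Rf : FiberCurvature I F V} {p : B}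

theorem exists_linearIndependent_pair (hE : 2 ≤ Module.finrank ℝ E) {X : TangentSpace I p}
    (hX : X ≠ 0) : ∃ Y : TangentSpace I p, LinearIndependent ℝ ![X, Y] := by
  obtain ⟨Y, hY⟩ : ∃ Y, Y ∉ Submodule.span ℝ {X} := by
    by_contra! hall
    have htop : Submodule.span ℝ {X} = ⊤ := Submodule.eq_top_iff'.2 hall
    have h1 : Module.finrank ℝ (TangentSpace I p) = 1 := by
      rw [← finrank_top, ← htop, finrank_span_singleton hX]
    have h2 : Module.finrank ℝ (TangentSpace I p) = Module.finrank ℝ E := rfl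
    omega
  exact ⟨Y, linearIndependent_pair_of_notMem hX hY⟩

theorem IsGood.mul_pos {W U : V p} (h : IsGood g D Rf U) (hWU : Orthonormal ℝ ![W, U])
    {X Y : TangentSpace I p} (hXY : LinearIndependent ℝ ![X, Y]) :
    0 < (g.inner p (curvatureVector g D W U X) (curvatureVector g D W U X)
      + 2 / 3 * secondDerivFiberCurvature g D Rf X W U) * baseCurvature g X Y :=
  (sq_nonneg _).trans_lt
    (h X Y W hXY (LinearIndependent.pair_symm_iff.1 hWU.linearIndependent))

theorem baseCurvature_ne_zero [LocallyCompactSpace B] (hF : 2 ≤ Module.finrank ℝ F)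
    (h : ∀ U : V p, ‖U‖ = 1 → IsGood g D Rf U) {X Y : TangentSpace I p}
    (hXY : LinearIndependent ℝ ![X, Y]) : baseCurvature g X Y ≠ 0 := by
  -- Maximality is discarded; only the existence of an orthonormal pair in the fiber over `p` is
  -- used.
  obtain ⟨q, rfl, W, U, hWU, -⟩ := exists_max hF Rf (isCompact_singleton (x := p))
    (Set.singleton_nonempty p)
  exact right_ne_zero_of_mul ((h U (hWU.1 1)).mul_pos hWU hXY).ne'

/-- The base curvature has constant sign on each tangent space if all unit vectors are good. -/
theorem baseCurvature_pos_of_pos [LocallyCompactSpace B] (hE : 3 ≤ Module.finrank ℝ E)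
    (hF : 2 ≤ Module.finrank ℝ F)
    (h : ∀ U : V p, ‖U‖ = 1 → IsGood g D Rf U) {X Y X' Y' : TangentSpace I p}
    (hpos : 0 < baseCurvature g X Y) (hXY' : LinearIndependent ℝ ![X', Y']) :
    0 < baseCurvature g X' Y' := by
  have hE' : 3 ≤ Module.finrank ℝ (TangentSpace I p) := hE
  exact pos_of_pos hE' (fun _ _ => baseCurvature_ne_zero hF h)
    (continuous_baseCurvature_right g) (continuous_baseCurvature_left g)
    (by
      by_contra hXY
      exact hpos.ne' (baseCurvature_eq_zero g hXY)) hXY' hpos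

/-- The sign is constant on each tangent space and never zero on planes, so the two open sets are
complementary, hence closed in the compact `B`. -/
theorem isCompact_setOf_baseCurvature_pos [CompactSpace B] [LocallyCompactSpace B]
    (hE : 3 ≤ Module.finrank ℝ E) (hF : 2 ≤ Module.finrank ℝ F)
    (h : ∀ (p : B) (U : V p), ‖U‖ = 1 → IsGood g D Rf U) :
    IsCompact {p : B | ∃ X Y : TangentSpace I p, 0 < baseCurvature g X Y} ∧
      IsCompact {p : B | ∃ X Y : TangentSpace I p, baseCurvature g X Y < 0} := by
  have hcompl : {p : B | ∃ X Y : TangentSpace I p, 0 < baseCurvature g X Y}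
      = {p : B | ∃ X Y : TangentSpace I p, baseCurvature g X Y < 0}ᶜ := by
    ext p
    constructor
    · rintro ⟨X, Y, hXY⟩ ⟨X', Y', hXY'⟩
      refine hXY'.not_gt (baseCurvature_pos_of_pos hE hF (h p) hXY ?_)
      by_contra hd
      exact hXY'.ne (baseCurvature_eq_zero g hd)
    · intro hp
      have : Nontrivial (TangentSpace I p) :=
        Module.nontrivial_of_finrank_pos (R := ℝ) (M := E) (by omega)
      obtain ⟨X, hX⟩ := exists_ne (0 : TangentSpace I p)
      obtain ⟨Y, hY⟩ := exists_linearIndependent_pair (by omega) hX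
      exact ⟨X, Y, lt_of_le_of_ne (not_lt.1 fun hlt => hp ⟨X, Y, hlt⟩)
        (baseCurvature_ne_zero hF (h p) hY).symm⟩
  have hpos := isOpen_setOf_baseCurvature g (isOpen_lt' (0 : ℝ))
  have hneg := isOpen_setOf_baseCurvature g (isOpen_gt' (0 : ℝ))
  refine ⟨?_, ?_⟩
  · rw [hcompl]
    exact hneg.isClosed_compl.isCompact
  · rw [← compl_compl {p : B | ∃ X Y : TangentSpace I p, baseCurvature g X Y < 0}, ← hcompl]
    exact hpos.isClosed_compl.isCompact

theorem not_forall_isGood [CompactSpace B] [Nonempty B] [LocallyCompactSpace B]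
    [BoundarylessManifold I B] (hE : 3 ≤ Module.finrank ℝ E) (hE' : Odd (Module.finrank ℝ E))
    (hF : 2 ≤ Module.finrank ℝ F) (hD : PreservesSmooth D) (hDm : D.IsMetricCompatible) :
    ¬ ∀ (p : B) (U : V p), ‖U‖ = 1 → IsGood g D Rf U := by
  intro h
  obtain ⟨hc, hc'⟩ := isCompact_setOf_baseCurvature_pos hE hF h
  have hpos := isOpen_setOf_baseCurvature g (isOpen_lt' (0 : ℝ))
  have hneg := isOpen_setOf_baseCurvature g (isOpen_gt' (0 : ℝ))
  by_cases hne : {p : B | ∃ X Y : TangentSpace I p, 0 < baseCurvature g X Y}.Nonempty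
  · obtain ⟨q, ⟨A, C, hAC⟩, W, U, hWU, X, hX, hX0, hle⟩ :=
      exists_curvatureVector_eq_zero_and_nonpos (g := g) hE' hF hD hDm Rf hc hpos hne
    obtain ⟨Y, hXY⟩ := exists_linearIndependent_pair (by omega) hX
    have h1 := (h q U (hWU.1 1)).mul_pos hWU hXY
    -- Positive `k_B` forces the first factor to be positive, whereas at the maximum it reduces to a
    -- nonpositive second derivative.
    have h2 := pos_of_mul_pos_left h1 (baseCurvature_pos_of_pos hE hF (h q) hAC hXY).le
    rw [hX0, map_zero] at h2
    linarith
  · have hne' : {p : B | ∃ X Y : TangentSpace I p, baseCurvature g X Y < 0}.Nonempty := by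
      obtain ⟨p⟩ := ‹Nonempty B›
      have : Nontrivial (TangentSpace I p) :=
        Module.nontrivial_of_finrank_pos (R := ℝ) (M := E) (by omega)
      obtain ⟨X, hX⟩ := exists_ne (0 : TangentSpace I p)
      obtain ⟨Y, hY⟩ := exists_linearIndependent_pair (by omega) hX
      exact ⟨p, X, Y, lt_of_le_of_ne (not_lt.1 fun hlt => hne ⟨p, X, Y, hlt⟩)
        (baseCurvature_ne_zero hF (h p) hY)⟩
    -- For `-Rf` the maximum is a minimum of `k^f`: the first factor is nonnegative and `k_B ≤ 0`,
    -- so the product cannot be positive.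
    obtain ⟨q, -, W, U, hWU, X, hX, hX0, hle⟩ :=
      exists_curvatureVector_eq_zero_and_nonpos (g := g) hE' hF hD hDm (-Rf) hc' hneg hne'
    obtain ⟨Y, hXY⟩ := exists_linearIndependent_pair (by omega) hX
    have h1 := (h q U (hWU.1 1)).mul_pos hWU hXY
    have h2 : baseCurvature g X Y ≤ 0 := not_lt.1 fun hlt => hne ⟨q, X, Y, hlt⟩
    rw [secondDerivFiberCurvature_neg] at hle
    rw [hX0, map_zero] at h1
    nlinarith

end MainTheorem

end SoulInequality

theorem mainTheorem11 {n : ℕ} (hn : Odd n) (hn1 : n ≠ 1)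
    {B : Type*} [TopologicalSpace B] [T2Space B] [CompactSpace B] [Nonempty B]
    [ChartedSpace (EuclideanSpace ℝ (Fin n)) B] [IsManifold (𝓡 n) ∞ B]
    {F : Type*} [NormedAddCommGroup F] [NormedSpace ℝ F] [FiniteDimensional ℝ F]
    (hF : 2 ≤ Module.finrank ℝ F)
    {V : B → Type*} [TopologicalSpace (TotalSpace F V)]
    [∀ x, NormedAddCommGroup (V x)] [∀ x, InnerProductSpace ℝ (V x)]
    [FiberBundle F V] [VectorBundle ℝ F V] [ContMDiffVectorBundle ∞ F V (𝓡 n)]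
    [IsContMDiffRiemannianBundle (𝓡 n) ∞ F V]
    (g : ContMDiffRiemannianMetric (𝓡 n) ∞ (EuclideanSpace ℝ (Fin n))
      (fun x : B => TangentSpace (𝓡 n) x))
    (D : CovariantDerivative (𝓡 n) F V) [D.ContMDiffCovariantDerivative ∞]
    (hD : D.IsMetricCompatible)
    (Rf : SoulInequality.FiberCurvature (𝓡 n) F V) :
    ¬ ∀ (p : B) (U : V p), ‖U‖ = 1 → SoulInequality.IsGood g D Rf U := by
  have : LocallyCompactSpace B := ChartedSpace.locallyCompactSpace (EuclideanSpace ℝ (Fin n)) B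
  have hE : Module.finrank ℝ (EuclideanSpace ℝ (Fin n)) = n := finrank_euclideanSpace_fin
  have h3 : 3 ≤ n := by
    obtain ⟨k, rfl⟩ := hn
    omega
  exact SoulInequality.not_forall_isGood (hE.symm ▸ h3) (hE.symm ▸ hn) hF
    (SoulInequality.preservesSmooth_of_contMDiff D) hD
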